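/- Let $G$ be the graph on the $98$ vertices $r$, $w_0,\dots,w_{48}$, $v_1,\dots,v_{48}$ whose edges are $rw_i$ for $0\le i\le 48$, and $w_{j-1}w_j$, $w_{j-1}v_j$, $w_jv_j$ for $1\le j\le 48$. Then $G$ is outerplanar (it can be drawn in the plane without crossings so that every vertex lies on the boundary of the outer face), $G$ is a $2$-tree (it can be constructed from $K_2$ by iteratively adding a new vertex of degree $2$ whose two neighbors are adjacent), and $$\chi_{cg}(G)=\mathrm{col}_{cg}(G)=5.$$ In particular, there exists an outerplanar $2$-tree with connected game chromatic number and connected game coloring number equal to $5$. Here $\chi_{cg}(G)$ is the least $k$ for which Alice has a winning strategy in the connected coloring game with $k$ colors: Alice and Bob, Alice first, alternately color an uncolored vertex of $G$ with one of the $k$ colors that does not yet occur at a neighbor of it, and must play so that the set of colored vertices always induces a connected subgraph; Alice wins if all of $G$ gets colored, and Bob wins if some vertex is uncolored but no legal move exists. Likewise, $\mathrm{col}_{cg}(G)$ is the least $k$ for which Alice has a strategy in the connected marking game to ensure that in every state of the game each unmarked vertex has at most $k-1$ marked neighbors; in this game Alice and Bob, Alice first, alternately mark an unmarked vertex of $G$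 so that the set of marked vertices always induces a connected subgraph. -/

import Mathlib

/-- The two players of the games. -/
inductive Player
  | alice
  | bob

section Games

variable {V : Type*} (G : SimpleGraph V)

/-- `IsColoringMove G f g`: in the connected coloring game on `G` with `k` colors, `g` arises from
the partial coloring `f` by one legal move: an uncolored vertex `v` receives a color `c` that does
not occur at a neighbor of `v`, and afterwards the colored vertices induce a connected graph. -/
def IsColoringMove {k : ℕ} (f g : V → Option (Fin k)) : Prop :=
  ∃ (v : V) (c : Fin k), f v = none ∧ (∀ u, G.Adj v u → f u ≠ some c) ∧
    g v = some c ∧ (∀ u, u ≠ v → g u = f u) ∧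
    (G.induce {u | g u ≠ none}).Connected

/-- `AliceWinsColoring G k p f`: in the connected coloring game on `G` with `k` colors, Alice has a
winning strategy from the partial coloring `f` when player `p` is to move. Alice wins if all
vertices are colored; a position with an uncolored vertex and no legal move is lost for her. -/
inductive AliceWinsColoring (k : ℕ) : Player → (V → Option (Fin k)) → Prop
  | complete (p : Player) (f : V → Option (Fin k)) (hf : ∀ v, f v ≠ none) :
      AliceWinsColoring k p f
  | alice_moves (f g : V → Option (Fin k)) (hfg : IsColoringMove G f g)
      (hg : AliceWinsColoring k Player.bob g) : AliceWinsColoring k Player.alice f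
  | bob_moves (f : V → Option (Fin k)) (hf : ∃ g, IsColoringMove G f g)
      (hg : ∀ g, IsColoringMove G f g → AliceWinsColoring k Player.alice g) :
      AliceWinsColoring k Player.bob f

/-- The connected game chromatic number: the least number `k` of colors for which Alice, who moves
first on the uncolored graph, has a winning strategy in the connected coloring game
(`⊤` if there is none). -/
noncomputable def connectedGameChromaticNumber : ℕ∞ :=
  ⨅ (k : ℕ) (_ : AliceWinsColoring G k Player.alice (fun _ => none)), (k : ℕ∞)

/-- `IsMarkingMove G S T`: in the connected marking game, the set `T` of marked vertices arises
from `S` by marking one more vertex, and `T` induces a connected graph. -/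
def IsMarkingMove (S T : Set V) : Prop :=
  ∃ v, v ∉ S ∧ T = insert v S ∧ (G.induce T).Connected

/-- Every unmarked vertex has at most `k - 1` marked neighbors (in particular, if `k = 0` then no
vertex is unmarked). -/
def MarkedNeighborsLT (k : ℕ) (S : Set V) : Prop :=
  ∀ v, v ∉ S → (G.neighborSet v ∩ S).encard < k

/-- `AliceLimitsMarking G k p S`: in the connected marking game on `G`, from the set `S` of marked
vertices and with player `p` to move, Alice has a strategy by which all vertices get marked and in
each state of the game, the present one included, every unmarked vertex has at most `k - 1` marked
neighbors. -/
inductive AliceLimitsMarking (k : ℕ) : Player → Set V → Prop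
  | complete (p : Player) (S : Set V) (hS : S = Set.univ) : AliceLimitsMarking k p S
  | alice_moves (S T : Set V) (hS : MarkedNeighborsLT G k S) (hST : IsMarkingMove G S T)
      (hT : AliceLimitsMarking k Player.bob T) : AliceLimitsMarking k Player.alice S
  | bob_moves (S : Set V) (hS : MarkedNeighborsLT G k S) (hmove : ∃ T, IsMarkingMove G S T)
      (hT : ∀ T, IsMarkingMove G S T → AliceLimitsMarking k Player.alice T) :
      AliceLimitsMarking k Player.bob S

/-- The connected game coloring number: the least `k` for which Alice, who moves first on the
unmarked graph, has a strategy in the connected marking game that keeps the number of marked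
neighbors of every unmarked vertex at most `k - 1` throughout the game (`⊤` if there is none). -/
noncomputable def connectedGameColoringNumber : ℕ∞ :=
  ⨅ (k : ℕ) (_ : AliceLimitsMarking G k Player.alice ∅), (k : ℕ∞)

end Games

section GraphClasses

variable {V : Type*}

/-- `IsKTreeOn G k S`: the subgraph of `G` induced by `S` can be constructed from a copy of the
complete graph on `k` vertices by iteratively adding a new vertex that has exactly `k` neighbors
among the earlier vertices, these neighbors being pairwise adjacent. -/
inductive IsKTreeOn (G : SimpleGraph V) (k : ℕ) : Set V → Prop
  | base (S : Set V) (hcard : S.encard = k) (hclique : G.IsClique S) : IsKTreeOn G k S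
  | add (S : Set V) (v : V) (hS : IsKTreeOn G k S) (hv : v ∉ S)
      (hcard : (G.neighborSet v ∩ S).encard = k) (hclique : G.IsClique (G.neighborSet v ∩ S)) :
      IsKTreeOn G k (insert v S)

/-- `G` is a `k`-tree. -/
def IsKTree (G : SimpleGraph V) (k : ℕ) : Prop :=
  IsKTreeOn G k Set.univ

/-- A drawing of `G` in the plane (here `ℂ`) without crossings: vertices are distinct points, edges
are simple arcs joining the points of their end vertices, arcs contain vertex points only as their
endpoints, and different arcs meet at most in endpoints. -/
structure PlaneDrawing (G : SimpleGraph V) where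
  point : V → ℂ
  point_injective : Function.Injective point
  arc : G.edgeSet → unitInterval → ℂ
  arc_continuous : ∀ e, Continuous (arc e)
  arc_injective : ∀ e, Function.Injective (arc e)
  arc_ends : ∀ e : G.edgeSet, s(arc e 0, arc e 1) = Sym2.map point (e : Sym2 V)
  arc_avoids : ∀ e t v, arc e t = point v → t = 0 ∨ t = 1
  arc_disjoint : ∀ e e', e ≠ e' → ∀ t t', arc e t = arc e' t' →
    (t = 0 ∨ t = 1) ∧ (t' = 0 ∨ t' = 1)

/-- The set of points of the plane that are covered by the drawing. -/
def PlaneDrawing.support {G : SimpleGraph V} (D : PlaneDrawing G) : Set ℂ :=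
  Set.range D.point ∪ ⋃ e, Set.range (D.arc e)

/-- The outer face: the points of the complement of the drawing whose connected component in the
complement is unbounded. -/
def PlaneDrawing.outerFace {G : SimpleGraph V} (D : PlaneDrawing G) : Set ℂ :=
  {z | z ∈ D.supportᶜ ∧ ¬ Bornology.IsBounded (connectedComponentIn D.supportᶜ z)}

/-- `G` is outerplanar: it has a drawing in the plane without crossings in which every vertex lies
on the boundary of the outer face. -/
def IsOuterplanar (G : SimpleGraph V) : Prop :=
  ∃ D : PlaneDrawing G, ∀ v, D.point v ∈ frontier D.outerFace

end GraphClasses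

/-- The vertices `r`, `w₀, …, w₄₈` and `v₁, …, v₄₈`; here `v j` stands for `v_{j+1}`. -/
inductive FanVertex
  | r
  | w (i : Fin 49)
  | v (j : Fin 48)
  deriving DecidableEq, Fintype

/-- The edges, each in one direction: `r wᵢ`, `wᵢ wᵢ₊₁`, and `wⱼ₋₁ vⱼ`, `wⱼ vⱼ`. -/
def FanEdge : FanVertex → FanVertex → Prop
  | .r, .w _ => True
  | .w i, .w i' => i.val + 1 = i'.val
  | .w i, .v j => i = j.castSucc ∨ i = j.succ
  | _, _ => False

/-- The graph on the vertices `r`, `w₀, …, w₄₈`, `v₁, …, v₄₈` in which `r` is adjacent to all `wᵢ`,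
the `wᵢ` form a path in this order, and `vⱼ` is adjacent to `wⱼ₋₁` and `wⱼ`. -/
def fanGraph : SimpleGraph FanVertex :=
  SimpleGraph.fromRel FanEdge

/-! Upper bound. After each of her moves Alice has `r` marked and both neighbors of every marked ear
marked (`IsEarClosed`). An unmarked spine vertex then has no marked ear, so at most three marked
neighbors, and at most four after Bob's next move; ears have degree two. If Bob marks an ear,
connectedness forces one of its neighbors to be marked already, and Alice marks the other unless it
is marked too. Hence the coloring number is at most 5. Since a vertex with fewer than `k` marked
neighbors always has a free color, a marking strategy is a coloring strategy
(`AliceLimitsMarking.aliceWinsColoring`), so both equalities follow once Bob wins the coloring game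
with at most 4 colors.

Lower bound. Fewer than 3 colors fail on a triangle. Bob's tool is connectedness: once `r` is
colored, no ear can be colored before one of its two neighbors, so inside a stretch of uncolored
spine vertices Alice has few defenses. With 4 colors Bob aims at an uncolored spine vertex that sees
`r` and three more colors. He wins when two colored spine vertices bound an uncolored stretch of
even distance at least 4 (`not_alice_of_even_gap`, where each threat shortens the gap by two) or of
odd distance at least 7 (`not_alice_of_odd_gap`, where every defense that survives leaves an even
gap). After a colored vertex followed by 12 uncolored ones he creates a gap of length 12; however
Alice cuts it, one piece has length at least 6 and is won by one of these lemmas. The path is long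
enough, and symmetric, so that such a run survives the opening.

Outerplanarity. The vertices are placed on a parabola in the order of the outer cycle, and edges are
drawn as chords. -/

namespace FanVertex

/-- The vertex `w i` for `i < 49`. -/
def spine (i : ℕ) : FanVertex := .w (Fin.ofNat 49 i)

/-- The vertex `v j` for `j < 48`, adjacent to `spine j` and `spine (j + 1)`. -/
def ear (j : ℕ) : FanVertex := .v (Fin.ofNat 48 j)

theorem eq_r_or_spine_or_ear (u : FanVertex) :
    u = r ∨ (∃ i < 49, u = spine i) ∨ ∃ j < 48, u = ear j := by
  rcases u with _ | i | j
  · exact Or.inl rfl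
  · exact Or.inr (Or.inl ⟨i, i.2, by simp [spine]⟩)
  · exact Or.inr (Or.inr ⟨j, j.2, by simp [ear]⟩)

theorem spine_inj {i j : ℕ} (hi : i < 49) (hj : j < 49) : spine i = spine j ↔ i = j := by
  simp [spine, Fin.ext_iff, Nat.mod_eq_of_lt hi, Nat.mod_eq_of_lt hj]

theorem ear_inj {i j : ℕ} (hi : i < 48) (hj : j < 48) : ear i = ear j ↔ i = j := by
  simp [ear, Fin.ext_iff, Nat.mod_eq_of_lt hi, Nat.mod_eq_of_lt hj]

@[simp] theorem spine_ne_r (i : ℕ) : spine i ≠ r := by simp [spine]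
@[simp] theorem r_ne_spine (i : ℕ) : r ≠ spine i := by simp [spine]
@[simp] theorem ear_ne_r (i : ℕ) : ear i ≠ r := by simp [ear]
@[simp] theorem r_ne_ear (i : ℕ) : r ≠ ear i := by simp [ear]
@[simp] theorem spine_ne_ear (i j : ℕ) : spine i ≠ ear j := by simp [spine, ear]
@[simp] theorem ear_ne_spine (i j : ℕ) : ear i ≠ spine j := by simp [spine, ear]

theorem card_eq : Nat.card FanVertex = 98 := by
  rw [Nat.card_eq_fintype_card]; decide

end FanVertex

open FanVertex

/-! ### Adjacency and connected induced subgraphs -/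

namespace fanGraph

@[simp] theorem adj_r_spine (i : ℕ) : fanGraph.Adj r (spine i) := by
  simp [fanGraph, FanEdge, spine]

@[simp] theorem adj_spine_r (i : ℕ) : fanGraph.Adj (spine i) r := (adj_r_spine i).symm

theorem adj_spine_succ {i : ℕ} (hi : i < 48) : fanGraph.Adj (spine i) (spine (i + 1)) := by
  simp [fanGraph, FanEdge, spine, Fin.ext_iff, Nat.mod_eq_of_lt (show i < 49 by omega),
    Nat.mod_eq_of_lt (show i + 1 < 49 by omega)]

theorem adj_spine_ear {i : ℕ} (hi : i < 48) : fanGraph.Adj (spine i) (ear i) := by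
  simp [fanGraph, FanEdge, spine, ear, Fin.ext_iff, Nat.mod_eq_of_lt (show i < 49 by omega),
    Nat.mod_eq_of_lt hi]

theorem adj_spine_succ_ear {i : ℕ} (hi : i < 48) : fanGraph.Adj (spine (i + 1)) (ear i) := by
  simp [fanGraph, FanEdge, spine, ear, Fin.ext_iff, Nat.mod_eq_of_lt (show i + 1 < 49 by omega),
    Nat.mod_eq_of_lt hi]

theorem eq_spine_of_adj_r {u : FanVertex} (h : fanGraph.Adj r u) : ∃ i < 49, u = spine i := by
  rcases u with _ | i | j
  · simp [fanGraph] at h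
  · exact ⟨i, i.2, by simp [spine]⟩
  · simp [fanGraph, FanEdge] at h

theorem eq_of_adj_ear {j : ℕ} (hj : j < 48) {u : FanVertex} (h : fanGraph.Adj (ear j) u) :
    u = spine j ∨ u = spine (j + 1) := by
  rcases u with _ | i | i
  · simp [fanGraph, FanEdge, ear] at h
  · simp only [fanGraph, FanEdge, ear, SimpleGraph.fromRel_adj, Fin.ext_iff, Fin.val_ofNat,
      Fin.val_castSucc, Fin.val_succ, Nat.mod_eq_of_lt hj] at h
    rcases h with ⟨-, h | h | h⟩
    · exact h.elim
    · left; simp [spine, ← h]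
    · right; simp [spine, ← h]
  · simp [fanGraph, FanEdge, ear] at h

theorem eq_of_adj_spine {i : ℕ} (hi : i < 49) {u : FanVertex} (h : fanGraph.Adj (spine i) u) :
    u = r ∨ (∃ j < 49, (j + 1 = i ∨ j = i + 1) ∧ u = spine j) ∨
      ∃ j < 48, (j + 1 = i ∨ j = i) ∧ u = ear j := by
  rcases u with _ | l | l
  · exact Or.inl rfl
  · refine Or.inr (Or.inl ⟨l, l.2, ?_, by simp [spine]⟩)
    simp only [fanGraph, FanEdge, spine, SimpleGraph.fromRel_adj, Fin.val_ofNat,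
      Nat.mod_eq_of_lt hi] at h
    omega
  · refine Or.inr (Or.inr ⟨l, l.2, ?_, by simp [ear]⟩)
    simp only [fanGraph, FanEdge, spine, SimpleGraph.fromRel_adj, Fin.ext_iff, Fin.val_ofNat,
      Fin.val_castSucc, Fin.val_succ, Nat.mod_eq_of_lt hi, or_false] at h
    omega

/-- A set containing `r` induces a connected graph if every `ear` in it has a neighbor in it. -/
theorem induce_connected {S : Set FanVertex} (hr : r ∈ S)
    (hS : ∀ j < 48, ear j ∈ S → spine j ∈ S ∨ spine (j + 1) ∈ S) :
    (fanGraph.induce S).Connected := by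
  have hspine : ∀ i (h : spine i ∈ S), (fanGraph.induce S).Reachable ⟨r, hr⟩ ⟨spine i, h⟩ :=
    fun i h => SimpleGraph.Adj.reachable (by simp)
  have hreach : ∀ u : S, (fanGraph.induce S).Reachable ⟨r, hr⟩ u := by
    rintro ⟨u, hu⟩
    rcases eq_r_or_spine_or_ear u with rfl | ⟨i, hi, rfl⟩ | ⟨j, hj, rfl⟩
    · exact SimpleGraph.Reachable.refl _
    · exact hspine i hu
    · rcases hS j hj hu with h | h
      · exact (hspine _ h).trans (SimpleGraph.Adj.reachable (by simpa using adj_spine_ear hj))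
      · exact (hspine _ h).trans (SimpleGraph.Adj.reachable (by simpa using adj_spine_succ_ear hj))
  have : Nonempty S := ⟨⟨r, hr⟩⟩
  exact ⟨fun a b => (hreach a).symm.trans (hreach b)⟩

/-- In a connected induced subgraph with a second vertex, every `ear` has a neighbor. -/
theorem spine_mem_of_connected {S : Set FanVertex} (hS : (fanGraph.induce S).Connected)
    {j : ℕ} (hj : j < 48) (hjS : ear j ∈ S) {u : FanVertex} (hu : u ∈ S) (hne : u ≠ ear j) :
    spine j ∈ S ∨ spine (j + 1) ∈ S := by
  have : Nontrivial S := ⟨⟨u, hu⟩, ⟨ear j, hjS⟩, by simpa using hne⟩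
  obtain ⟨⟨x, hx⟩, hadj⟩ := hS.preconnected.exists_adj_of_nontrivial ⟨ear j, hjS⟩
  rcases eq_of_adj_ear hj (show fanGraph.Adj (ear j) x from hadj) with rfl | rfl
  · exact Or.inl hx
  · exact Or.inr hx

end fanGraph

/-! ### General facts on the two games -/

section Games

variable {V : Type*} {G : SimpleGraph V}

theorem IsColoringMove.eq_update [DecidableEq V] {k : ℕ} {f g : V → Option (Fin k)}
    (h : IsColoringMove G f g) :
    ∃ v c, f v = none ∧ (∀ u, G.Adj v u → f u ≠ some c) ∧ g = Function.update f v (some c) ∧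
      (G.induce {u | g u ≠ none}).Connected := by
  obtain ⟨v, c, hv, hc, hgv, hg, hconn⟩ := h
  refine ⟨v, c, hv, hc, ?_, hconn⟩
  funext u
  by_cases hu : u = v
  · subst hu; simpa using hgv
  · simpa [hu] using hg u hu

theorem setOf_update_ne_none [DecidableEq V] {k : ℕ} (f : V → Option (Fin k)) (v : V) (c : Fin k) :
    {u | Function.update f v (some c) u ≠ none} = insert v {u | f u ≠ none} := by
  ext u
  by_cases hu : u = v <;> simp [hu]

theorem isColoringMove_update [DecidableEq V] {k : ℕ} {f : V → Option (Fin k)} {v : V} {c : Fin k}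
    (hv : f v = none) (hc : ∀ u, G.Adj v u → f u ≠ some c)
    (hconn : (G.induce (insert v {u | f u ≠ none})).Connected) :
    IsColoringMove G f (Function.update f v (some c)) := by
  refine ⟨v, c, hv, hc, by simp, fun u hu => by simp [hu], ?_⟩
  rwa [setOf_update_ne_none]

/-- If every color were blocked, choosing a blocking neighbor for each color would embed the `k`
colors into the colored neighbors of `v`. -/
theorem exists_color_of_encard_lt {k : ℕ} {S : Set V} {f : V → Option (Fin k)}
    (hf : {u | f u ≠ none} = S) {v : V} (h : (G.neighborSet v ∩ S).encard < k) :
    ∃ c, ∀ u, G.Adj v u → f u ≠ some c := by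
  by_contra! hcon
  choose φ hφ hφc using hcon
  have hinj : Function.Injective φ := fun c d hcd => by
    have := hφc c
    rw [hcd, hφc d] at this
    exact (Option.some.inj this).symm
  have hsub : Set.range φ ⊆ G.neighborSet v ∩ S := by
    rintro _ ⟨c, rfl⟩
    exact ⟨hφ c, by rw [← hf]; simp [hφc c]⟩
  have := Set.encard_le_encard hsub
  rw [← Set.image_univ, hinj.encard_image, Set.encard_univ, ENat.card_eq_coe_fintype_card,
    Fintype.card_fin] at this
  exact absurd h (not_lt.mpr this)

/-- A marking strategy for Alice is also a strategy in the coloring game. -/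
theorem AliceLimitsMarking.aliceWinsColoring {k : ℕ} {p : Player} {S : Set V}
    (h : AliceLimitsMarking G k p S) (f : V → Option (Fin k)) (hf : {u | f u ≠ none} = S) :
    AliceWinsColoring G k p f := by
  classical
  have hmem : ∀ {S : Set V} {f : V → Option (Fin k)}, {u | f u ≠ none} = S →
      ∀ {u}, u ∉ S → f u = none := by
    rintro S f rfl u hu
    simpa using hu
  have hmove : ∀ {S T : Set V} {f : V → Option (Fin k)}, {u | f u ≠ none} = S →
      MarkedNeighborsLT G k S → IsMarkingMove G S T →
      ∃ g, IsColoringMove G f g ∧ {u | g u ≠ none} = T := by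
    rintro S T f hf hS ⟨v, hv, rfl, hconn⟩
    obtain ⟨c, hc⟩ := exists_color_of_encard_lt hf (hS v hv)
    refine ⟨Function.update f v (some c), isColoringMove_update (hmem hf hv) hc ?_, ?_⟩
    · rwa [hf]
    · rw [setOf_update_ne_none, hf]
  induction h generalizing f with
  | complete p S hS =>
    subst hS
    exact .complete p f fun v => (Set.eq_univ_iff_forall.mp hf) v
  | alice_moves S T hS hST hT ih =>
    obtain ⟨g, hg, hgT⟩ := hmove hf hS hST
    exact .alice_moves f g hg (ih g hgT)
  | bob_moves S hS hex hT ih =>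
    obtain ⟨T, hT'⟩ := hex
    obtain ⟨g, hg, -⟩ := hmove hf hS hT'
    refine .bob_moves f ⟨g, hg⟩ fun g hg => ?_
    obtain ⟨v, c, hv, -, rfl, hconn⟩ := hg.eq_update
    rw [setOf_update_ne_none, hf] at hconn
    refine ih (insert v S) ⟨v, ?_, rfl, hconn⟩ _ (by rw [setOf_update_ne_none, hf])
    rw [← hf]; simpa using hv

theorem proper_update [DecidableEq V] {k : ℕ} {f : V → Option (Fin k)}
    (hf : ∀ u v, G.Adj u v → ∀ c, f u = some c → f v ≠ some c)
    {x : V} {d : Fin k} (hd : ∀ u, G.Adj x u → f u ≠ some d) :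
    ∀ u v, G.Adj u v → ∀ c, Function.update f x (some d) u = some c →
      Function.update f x (some d) v ≠ some c := by
  intro u v huv c hu hv
  by_cases hux : u = x
  · subst hux
    simp only [Function.update_self, Option.some.injEq] at hu
    subst hu
    rw [Function.update_of_ne huv.ne'] at hv
    exact hd v huv hv
  · rw [Function.update_of_ne hux] at hu
    by_cases hvx : v = x
    · subst hvx
      simp only [Function.update_self, Option.some.injEq] at hv
      subst hv
      exact hd u huv.symm hu
    · rw [Function.update_of_ne hvx] at hv
      exact hf u v huv c hu hv

/-- If Alice wins the coloring game from a proper partial coloring, then there is a proper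
coloring. -/
theorem AliceWinsColoring.colorable {k : ℕ} {p : Player} {f : V → Option (Fin k)}
    (h : AliceWinsColoring G k p f)
    (hf : ∀ u v, G.Adj u v → ∀ c, f u = some c → f v ≠ some c) : G.Colorable k := by
  classical
  have hmove : ∀ {f g : V → Option (Fin k)}, IsColoringMove G f g →
      (∀ u v, G.Adj u v → ∀ c, f u = some c → f v ≠ some c) →
      ∀ u v, G.Adj u v → ∀ c, g u = some c → g v ≠ some c := by
    intro f g hg hf
    obtain ⟨x, d, -, hd, rfl, -⟩ := hg.eq_update
    exact proper_update hf hd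
  induction h with
  | complete p f hc =>
    choose φ hφ using fun v => Option.ne_none_iff_exists'.mp (hc v)
    exact ⟨SimpleGraph.Coloring.mk φ fun {u v} huv he =>
      hf u v huv (φ u) (hφ u) (he ▸ hφ v)⟩
  | alice_moves f g hg _ ih => exact ih (hmove hg hf)
  | bob_moves f hex _ ih =>
    obtain ⟨g, hg⟩ := hex
    exact ih g hg (hmove hg hf)

theorem IsColoringMove.comp_iso {k : ℕ} {f g : V → Option (Fin k)} (σ : G ≃g G)
    (h : IsColoringMove G f g) : IsColoringMove G (f ∘ σ) (g ∘ σ) := by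
  obtain ⟨v, c, hv, hc, hgv, hg, hconn⟩ := h
  refine ⟨σ.symm v, c, by simpa using hv, fun u hu => hc _ ?_, by simpa using hgv,
    fun u hu => hg _ fun h => hu (by simp [← h]), ?_⟩
  · simpa using σ.map_adj_iff.mpr hu
  · refine (SimpleGraph.Iso.connected_iff (G := G.induce {u | (g ∘ σ) u ≠ none})
      (H := G.induce {u | g u ≠ none}) ?_).mpr hconn
    exact ⟨σ.toEquiv.subtypeEquiv fun a => by simp, by simp [σ.map_adj_iff]⟩

theorem AliceWinsColoring.comp_iso {k : ℕ} {p : Player} {f : V → Option (Fin k)} (σ : G ≃g G)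
    (h : AliceWinsColoring G k p f) : AliceWinsColoring G k p (f ∘ σ) := by
  induction h with
  | complete p f hf => exact .complete p _ fun v => hf _
  | alice_moves f g hg _ ih => exact .alice_moves _ _ (hg.comp_iso σ) ih
  | bob_moves f hex _ ih =>
    obtain ⟨g, hg⟩ := hex
    refine .bob_moves _ ⟨_, hg.comp_iso σ⟩ fun g hg => ?_
    have := ih (g ∘ σ.symm) (by
      have := hg.comp_iso σ.symm
      rwa [Function.comp_assoc, show (σ ∘ σ.symm : V → V) = id from by funext; simp,
        Function.comp_id] at this)
    rwa [Function.comp_assoc, show (σ.symm ∘ σ : V → V) = id from by funext; simp,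
      Function.comp_id] at this

/-- A position with an uncolored vertex that sees all colors is lost for Alice. -/
theorem not_aliceWinsColoring_of_sees_all {k : ℕ} {p : Player} {f : V → Option (Fin k)} {x : V}
    (hx : f x = none) (hall : ∀ c, ∃ u, G.Adj x u ∧ f u = some c) :
    ¬ AliceWinsColoring G k p f := by
  classical
  -- The situation is permanent: `x` can never be colored, and colors already placed around it stay.
  have hmove : ∀ {f g : V → Option (Fin k)}, IsColoringMove G f g → f x = none →
      (∀ c, ∃ u, G.Adj x u ∧ f u = some c) →
      g x = none ∧ ∀ c, ∃ u, G.Adj x u ∧ g u = some c := by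
    intro f g hg hx hall
    obtain ⟨v, c, hv, hc, rfl, -⟩ := hg.eq_update
    have hxv : x ≠ v := by
      rintro rfl
      obtain ⟨u, hu, huc⟩ := hall c
      exact hc u hu huc
    refine ⟨by simpa [hxv] using hx, fun d => ?_⟩
    obtain ⟨u, hu, hud⟩ := hall d
    refine ⟨u, hu, ?_⟩
    rw [Function.update_of_ne (by rintro rfl; simp [hv] at hud)]
    exact hud
  intro h
  induction h with
  | complete p f hf => exact hf x hx
  | alice_moves f g hg _ ih => exact ih (hmove hg hx hall).1 (hmove hg hx hall).2
  | bob_moves f hex _ ih =>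
    obtain ⟨g, hg⟩ := hex
    exact ih g hg (hmove hg hx hall).1 (hmove hg hx hall).2

theorem not_aliceWinsColoring_bob {k : ℕ} {f g : V → Option (Fin k)} (hfg : IsColoringMove G f g)
    (hg : ¬ AliceWinsColoring G k .alice g) : ¬ AliceWinsColoring G k .bob f := by
  intro h
  cases h with
  | complete p f hf =>
    obtain ⟨v, c, hv, -⟩ := hfg
    exact hf v hv
  | bob_moves f hex h => exact hg (h g hfg)

theorem not_aliceWinsColoring_alice {k : ℕ} {f : V → Option (Fin k)} {x : V} (hx : f x = none)
    (hg : ∀ g, IsColoringMove G f g → ¬ AliceWinsColoring G k .bob g) :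
    ¬ AliceWinsColoring G k .alice f := by
  intro h
  cases h with
  | complete p f hf => exact hf x hx
  | alice_moves f g hfg h => exact hg g hfg h

end Games

/-! ### Alice's marking strategy -/

namespace fanGraph

/-- The marked sets that Alice leaves to Bob: `r` is marked, and each marked `ear` has both its
neighbors marked. -/
structure IsEarClosed (S : Set FanVertex) : Prop where
  r_mem : r ∈ S
  left_mem : ∀ j < 48, ear j ∈ S → spine j ∈ S
  right_mem : ∀ j < 48, ear j ∈ S → spine (j + 1) ∈ S

theorem IsEarClosed.connected {S : Set FanVertex} (hS : IsEarClosed S) :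
    (fanGraph.induce S).Connected :=
  induce_connected hS.r_mem fun j hj h => Or.inl (hS.left_mem j hj h)

theorem IsEarClosed.insert_spine {S : Set FanVertex} (hS : IsEarClosed S) (i : ℕ) :
    IsEarClosed (insert (spine i) S) :=
  ⟨Or.inr hS.r_mem, fun j hj h => Or.inr (hS.left_mem j hj (by simpa using h)),
    fun j hj h => Or.inr (hS.right_mem j hj (by simpa using h))⟩

theorem IsEarClosed.insert_ear {S : Set FanVertex} (hS : IsEarClosed S) {j : ℕ}
    (hj : j < 48) (h₁ : spine j ∈ S) (h₂ : spine (j + 1) ∈ S) :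
    IsEarClosed (insert (ear j) S) := by
  refine ⟨Or.inr hS.r_mem, fun i hi h => ?_, fun i hi h => ?_⟩ <;>
  · rw [Set.mem_insert_iff, ear_inj hi hj] at h
    rcases h with rfl | h
    · exact Or.inr ‹_›
    · first | exact Or.inr (hS.left_mem i hi h) | exact Or.inr (hS.right_mem i hi h)

/-- An unmarked spine vertex has no ear in `S`, so its marked neighbors are among `r`, its two path
neighbors and the new vertex `x`. This count of four is the source of the bound 5. -/
theorem IsEarClosed.markedNeighborsLT_insert {S : Set FanVertex} (hS : IsEarClosed S)
    (x : FanVertex) : MarkedNeighborsLT fanGraph 5 (insert x S) := by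
  intro u hu
  have hfour : ∀ a b c d : FanVertex, ({a, b, c, d} : Set FanVertex).encard < (5 : ℕ) := by
    intro a b c d
    refine lt_of_le_of_lt (b := ((4 : ℕ) : ℕ∞)) ?_ (by norm_num)
    have h₁ := Set.encard_insert_le ({b, c, d} : Set FanVertex) a
    have h₂ := Set.encard_insert_le ({c, d} : Set FanVertex) b
    have h₃ := Set.encard_insert_le ({d} : Set FanVertex) c
    rw [Set.encard_singleton] at h₃
    calc _ ≤ _ := h₁
      _ ≤ (1 + 1 + 1 + 1 : ℕ∞) := by gcongr; exact h₂.trans (by gcongr)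
      _ = _ := by norm_num
  rcases eq_r_or_spine_or_ear u with rfl | ⟨i, hi, rfl⟩ | ⟨j, hj, rfl⟩
  · exact absurd (Or.inr hS.r_mem) hu
  -- At the ends of the path `i - 1` truncates and `spine (i + 1)` wraps around; this is harmless,
  -- as the set is only an upper bound.
  · refine lt_of_le_of_lt (Set.encard_le_encard ?_) (hfour x r (spine (i - 1)) (spine (i + 1)))
    rintro y ⟨hy, rfl | hyS⟩
    · simp
    rcases eq_of_adj_spine hi hy with rfl | ⟨l, hl, rfl | rfl, rfl⟩ | ⟨l, hl, h, rfl⟩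
    · simp
    · simp
    · simp
    · exfalso
      refine hu (Or.inr ?_)
      rcases h with rfl | rfl
      · exact hS.right_mem l hl hyS
      · exact hS.left_mem l hl hyS
  · refine lt_of_le_of_lt (Set.encard_le_encard ?_) (hfour x r (spine j) (spine (j + 1)))
    rintro y ⟨hy, -⟩
    rcases eq_of_adj_ear hj hy with rfl | rfl <;> simp

theorem IsEarClosed.exists_insert {S : Set FanVertex} (hS : IsEarClosed S) (hne : S ≠ Set.univ) :
    ∃ x ∉ S, IsEarClosed (insert x S) := by
  by_cases h : ∀ i < 49, spine i ∈ S
  · obtain ⟨x, hx⟩ := (Set.ne_univ_iff_exists_notMem S).mp hne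
    rcases eq_r_or_spine_or_ear x with rfl | ⟨i, hi, rfl⟩ | ⟨j, hj, rfl⟩
    · exact absurd hS.r_mem hx
    · exact absurd (h i hi) hx
    · exact ⟨_, hx, hS.insert_ear hj (h _ (by omega)) (h _ (by omega))⟩
  · push Not at h
    obtain ⟨i, -, hi⟩ := h
    exact ⟨_, hi, hS.insert_spine i⟩

/-- Alice can answer any move of Bob such that afterwards each marked `ear` has both its neighbors
marked. -/
theorem IsEarClosed.exists_answer {S : Set FanVertex} (hS : IsEarClosed S) {x : FanVertex}
    (hx : x ∉ S) (hconn : (fanGraph.induce (insert x S)).Connected)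
    (hne : insert x S ≠ Set.univ) : ∃ y ∉ insert x S, IsEarClosed (insert y (insert x S)) := by
  rcases eq_r_or_spine_or_ear x with rfl | ⟨i, hi, rfl⟩ | ⟨j, hj, rfl⟩
  · exact absurd hS.r_mem hx
  · exact (hS.insert_spine i).exists_insert hne
  · have hnbr : spine j ∈ S ∨ spine (j + 1) ∈ S := by
      simpa using spine_mem_of_connected hconn hj (Or.inl rfl) (Or.inr hS.r_mem) (by simp)
    by_cases h₁ : spine j ∈ S
    · by_cases h₂ : spine (j + 1) ∈ S
      · exact (hS.insert_ear hj h₁ h₂).exists_insert hne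
      · refine ⟨spine (j + 1), by simpa using h₂, ?_⟩
        -- Alice adds the missing neighbor; for the invariant it may be inserted before Bob's ear.
        rw [Set.insert_comm]
        exact (hS.insert_spine _).insert_ear hj (Or.inr h₁) (Or.inl rfl)
    · refine ⟨spine j, by simpa using h₁, ?_⟩
      rw [Set.insert_comm]
      exact (hS.insert_spine _).insert_ear hj (Or.inl rfl) (Or.inr (hnbr.resolve_left h₁))

/-- Induction on the number of unmarked vertices, over rounds consisting of a move of Bob and
Alice's answer. -/
theorem IsEarClosed.aliceLimitsMarking {S : Set FanVertex} (hS : IsEarClosed S) :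
    AliceLimitsMarking fanGraph 5 .bob S := by
  induction hn : Sᶜ.ncard using Nat.strong_induction_on generalizing S with
  | _ n ih =>
  subst hn
  by_cases hne : S = Set.univ
  · exact .complete _ _ hne
  obtain ⟨x, hx, hxS⟩ := hS.exists_insert hne
  have hlt : MarkedNeighborsLT fanGraph 5 S := by
    -- Since `r` is already in `S`, inserting it changes nothing, so the bound after a move of Bob
    -- also covers the position before it.
    have := hS.markedNeighborsLT_insert r
    rwa [Set.insert_eq_of_mem hS.r_mem] at this
  refine .bob_moves S hlt ⟨_, x, hx, rfl, hxS.connected⟩ ?_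
  rintro _ ⟨y, hy, rfl, hconn⟩
  by_cases hne' : insert y S = Set.univ
  · exact .complete _ _ hne'
  obtain ⟨z, hz, hzS⟩ := hS.exists_answer hy hconn hne'
  refine .alice_moves _ _ (hS.markedNeighborsLT_insert y) ⟨z, hz, rfl, hzS.connected⟩
    (ih _ ?_ hzS rfl)
  refine Set.ncard_lt_ncard (compl_lt_compl_iff_lt.mpr ?_) (Set.toFinite _)
  exact (Set.subset_insert y S).trans_ssubset (Set.ssubset_insert hz)

theorem aliceLimitsMarking_five : AliceLimitsMarking fanGraph 5 .alice ∅ := by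
  have h : IsEarClosed {r} := ⟨rfl, by simp, by simp⟩
  refine .alice_moves ∅ {r} (fun v _ => by simp) ⟨r, by simp, by simp, h.connected⟩
    h.aliceLimitsMarking

/-! ### The 2-tree construction: the fan first, then the ears -/

theorem isKTreeOn_r_spines {n : ℕ} (hn : n < 49) :
    IsKTreeOn fanGraph 2 {u | u = r ∨ ∃ i ≤ n, u = spine i} := by
  induction n with
  | zero =>
    have : {u | u = r ∨ ∃ i ≤ 0, u = spine i} = {r, spine 0} := by
      ext u; simp
    rw [this]
    refine .base _ (by rw [Set.encard_pair (by simp)]; rfl) ?_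
    rw [SimpleGraph.isClique_pair]
    simp
  | succ n ih =>
    have hadd : {u | u = r ∨ ∃ i ≤ n + 1, u = spine i} =
        insert (spine (n + 1)) {u | u = r ∨ ∃ i ≤ n, u = spine i} := by
      ext u
      simp only [Set.mem_ofPred_eq, Set.mem_insert_iff, Nat.le_succ_iff]
      aesop
    have hnbr : fanGraph.neighborSet (spine (n + 1)) ∩ {u | u = r ∨ ∃ i ≤ n, u = spine i} =
        {r, spine n} := by
      ext u
      constructor
      · rintro ⟨hu, rfl | ⟨i, hi, rfl⟩⟩
        · simp
        · rcases eq_of_adj_spine hn hu with h | ⟨l, hl, h, he⟩ | ⟨l, hl, h, he⟩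
          · simp at h
          · rw [spine_inj (by omega) hl] at he
            have : i = n := by omega
            simp [this]
          · simp at he
      · rintro (rfl | rfl)
        · simp
        · exact ⟨(adj_spine_succ (by omega)).symm, Or.inr ⟨n, le_rfl, rfl⟩⟩
    rw [hadd]
    refine .add _ _ (ih (by omega)) ?_ ?_ ?_
    · rintro (h | ⟨i, hi, h⟩)
      · simp at h
      · rw [spine_inj hn (by omega)] at h
        omega
    · rw [hnbr, Set.encard_pair (by simp)]; rfl
    · rw [hnbr, SimpleGraph.isClique_pair]
      simp

theorem isKTreeOn_ears {n : ℕ} (hn : n ≤ 48) :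
    IsKTreeOn fanGraph 2 {u | (u = r ∨ ∃ i ≤ 48, u = spine i) ∨ ∃ j < n, u = ear j} := by
  induction n with
  | zero => simpa using isKTreeOn_r_spines (show 48 < 49 by omega)
  | succ n ih =>
    have hadd : {u | (u = r ∨ ∃ i ≤ 48, u = spine i) ∨ ∃ j < n + 1, u = ear j} =
        insert (ear n) {u | (u = r ∨ ∃ i ≤ 48, u = spine i) ∨ ∃ j < n, u = ear j} := by
      ext u
      simp only [Set.mem_ofPred_eq, Set.mem_insert_iff, Nat.lt_succ_iff_lt_or_eq]
      aesop
    have hnbr : fanGraph.neighborSet (ear n) ∩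
        {u | (u = r ∨ ∃ i ≤ 48, u = spine i) ∨ ∃ j < n, u = ear j} = {spine n, spine (n + 1)} := by
      ext u
      constructor
      · rintro ⟨hu, -⟩
        exact eq_of_adj_ear hn hu
      · rintro (rfl | rfl)
        · exact ⟨(adj_spine_ear hn).symm, Or.inl (Or.inr ⟨n, by omega, rfl⟩)⟩
        · exact ⟨(adj_spine_succ_ear hn).symm, Or.inl (Or.inr ⟨n + 1, by omega, rfl⟩)⟩
    have hne : spine n ≠ spine (n + 1) := (adj_spine_succ hn).ne
    rw [hadd]
    refine .add _ _ (ih (by omega)) ?_ ?_ ?_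
    · rintro ((h | ⟨i, hi, h⟩) | ⟨i, hi, h⟩)
      · simp at h
      · simp at h
      · rw [ear_inj hn (by omega)] at h
        omega
    · rw [hnbr, Set.encard_pair hne]; rfl
    · rw [hnbr, SimpleGraph.isClique_pair]
      exact fun _ => adj_spine_succ hn

theorem isKTree : IsKTree fanGraph 2 := by
  have := isKTreeOn_ears (n := 48) le_rfl
  refine (congrArg (IsKTreeOn fanGraph 2) (Set.eq_univ_of_forall fun u => ?_)).mp this
  rcases eq_r_or_spine_or_ear u with rfl | ⟨i, hi, rfl⟩ | ⟨j, hj, rfl⟩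
  · simp
  · exact Or.inl (Or.inr ⟨i, by omega, rfl⟩)
  · exact Or.inr ⟨j, hj, rfl⟩

end fanGraph

/-! ### Bob's winning positions: gaps of even length -/

namespace fanGraph

variable {k : ℕ} {f g : FanVertex → Option (Fin k)}

/-- The positions of the coloring game in which `r` is colored. -/
structure IsPosition (f : FanVertex → Option (Fin k)) : Prop where
  r_ne : f r ≠ none
  support : ∀ j < 48, f (ear j) ≠ none → f (spine j) ≠ none ∨ f (spine (j + 1)) ≠ none
  proper : ∀ u v, fanGraph.Adj u v → ∀ c, f u = some c → f v ≠ some c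

/-- This is how connectedness helps Bob: inside an uncolored stretch of the path, ears are uncolored
and unavailable to Alice. -/
theorem IsPosition.ear_eq_none (hf : IsPosition f) {j : ℕ} (hj : j < 48)
    (h₁ : f (spine j) = none) (h₂ : f (spine (j + 1)) = none) : f (ear j) = none := by
  by_contra h
  rcases hf.support j hj h with h | h <;> contradiction

theorem IsPosition.spine_ne_r (hf : IsPosition f) {i : ℕ} {c : Fin k} (h : f r = some c) :
    f (spine i) ≠ some c :=
  hf.proper _ _ (adj_r_spine i) c h

/-- A legal move in a position where some vertex is colored leads to a position that satisfies the
support condition. -/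
theorem support_of_connected (hconn : (fanGraph.induce {u | f u ≠ none}).Connected)
    {x y : FanVertex} (hxy : x ≠ y) (hx : f x ≠ none) (hy : f y ≠ none) {j : ℕ} (hj : j < 48)
    (h : f (ear j) ≠ none) : f (spine j) ≠ none ∨ f (spine (j + 1)) ≠ none := by
  by_cases hxj : x = ear j
  · exact spine_mem_of_connected hconn hj h hy (by rintro rfl; exact hxy hxj)
  · exact spine_mem_of_connected hconn hj h hx hxj

theorem IsPosition.exists_eq_update (hf : IsPosition f) (h : IsColoringMove fanGraph f g) :
    ∃ x c, f x = none ∧ g = Function.update f x (some c) ∧ IsPosition g := by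
  obtain ⟨x, c, hx, hc, rfl, hconn⟩ := h.eq_update
  have hxr : x ≠ r := by rintro rfl; exact hf.r_ne hx
  have hr : Function.update f x (some c) r ≠ none := by
    rw [Function.update_of_ne hxr.symm]; exact hf.r_ne
  exact ⟨x, c, hx, rfl, hr, fun j hj h => support_of_connected hconn hxr (by simp) hr hj h,
    proper_update hf.proper hc⟩

/-- A sufficient condition for a move to be legal and to lead to a position with `r` colored. -/
theorem isColoringMove_update_of_support {x : FanVertex} {c : Fin k} (hx : f x = none)
    (hc : ∀ u, fanGraph.Adj x u → f u ≠ some c)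
    (hproper : ∀ u v, fanGraph.Adj u v → ∀ c, f u = some c → f v ≠ some c)
    (hr : Function.update f x (some c) r ≠ none)
    (hsupp : ∀ j < 48, Function.update f x (some c) (ear j) ≠ none →
      Function.update f x (some c) (spine j) ≠ none ∨
      Function.update f x (some c) (spine (j + 1)) ≠ none) :
    IsColoringMove fanGraph f (Function.update f x (some c)) ∧
      IsPosition (Function.update f x (some c)) := by
  refine ⟨isColoringMove_update hx hc ?_, hr, hsupp, proper_update hproper hc⟩
  rw [← setOf_update_ne_none f x c]
  exact induce_connected hr hsupp

theorem update_ne_none {x u : FanVertex} {c : Fin k} (h : f u ≠ none) :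
    Function.update f x (some c) u ≠ none := by
  by_cases hu : u = x <;> simp [hu, h]

theorem IsPosition.spine_move (hf : IsPosition f) {i : ℕ} {c : Fin k} (hi : i < 49)
    (hx : f (spine i) = none) (hr : f r ≠ some c)
    (hspine : ∀ j < 49, j + 1 = i ∨ j = i + 1 → f (spine j) ≠ some c)
    (hear : ∀ j < 48, j + 1 = i ∨ j = i → f (ear j) ≠ some c) :
    IsColoringMove fanGraph f (Function.update f (spine i) (some c)) ∧
      IsPosition (Function.update f (spine i) (some c)) := by
  refine isColoringMove_update_of_support hx ?_ hf.proper (update_ne_none hf.r_ne) ?_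
  · intro u hu
    rcases eq_of_adj_spine hi hu with rfl | ⟨j, hj, h, rfl⟩ | ⟨j, hj, h, rfl⟩
    · exact hr
    · exact hspine j hj h
    · exact hear j hj h
  · intro j hj h
    rw [Function.update_of_ne (by simp)] at h
    exact (hf.support j hj h).imp update_ne_none update_ne_none

theorem IsPosition.ear_move (hf : IsPosition f) {j : ℕ} {c : Fin k} (hj : j < 48)
    (hx : f (ear j) = none) (h₁ : f (spine j) ≠ some c) (h₂ : f (spine (j + 1)) ≠ some c)
    (hsupp : f (spine j) ≠ none ∨ f (spine (j + 1)) ≠ none) :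
    IsColoringMove fanGraph f (Function.update f (ear j) (some c)) ∧
      IsPosition (Function.update f (ear j) (some c)) := by
  refine isColoringMove_update_of_support hx ?_ hf.proper (update_ne_none hf.r_ne) ?_
  · intro u hu
    rcases eq_of_adj_ear hj hu with rfl | rfl
    · exact h₁
    · exact h₂
  · intro i hi h
    by_cases hij : i = j
    · subst hij
      exact hsupp.imp update_ne_none update_ne_none
    · rw [Function.update_of_ne (by rwa [Ne, ear_inj hi hj])] at h
      exact (hf.support i hi h).imp update_ne_none update_ne_none

/-- An uncolored `spine` vertex whose neighbors carry four colors is fatal for Alice. -/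
theorem not_alice_of_four {p : Player} (hk : k ≤ 4) {x : FanVertex} (hx : f x = none)
    {u₁ u₂ u₃ u₄ : FanVertex} (h₁ : fanGraph.Adj x u₁) (h₂ : fanGraph.Adj x u₂)
    (h₃ : fanGraph.Adj x u₃) (h₄ : fanGraph.Adj x u₄) {a b c d : Fin k} (ha : f u₁ = some a)
    (hb : f u₂ = some b) (hc : f u₃ = some c) (hd : f u₄ = some d)
    (hne : [a, b, c, d].Nodup) : ¬ AliceWinsColoring fanGraph k p f := by
  refine not_aliceWinsColoring_of_sees_all hx fun e => ?_
  have : e = a ∨ e = b ∨ e = c ∨ e = d := by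
    simp [Fin.ext_iff] at hne ⊢
    omega
  rcases this with rfl | rfl | rfl | rfl
  exacts [⟨_, h₁, ha⟩, ⟨_, h₂, hb⟩, ⟨_, h₃, hc⟩, ⟨_, h₄, hd⟩]

theorem exists_fourth (a b c : Fin 4) : ∃ d, d ≠ a ∧ d ≠ b ∧ d ≠ c := by
  revert a b c; decide

theorem IsPosition.exists_colors (hf : IsPosition f) {i j : ℕ} (hi : f (spine i) ≠ none)
    (hj : f (spine j) ≠ none) (hij : f (spine i) ≠ f (spine j)) :
    ∃ a b c, f r = some a ∧ f (spine i) = some b ∧ f (spine j) = some c ∧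
      a ≠ b ∧ a ≠ c ∧ b ≠ c := by
  obtain ⟨a, ha⟩ := Option.ne_none_iff_exists'.mp hf.r_ne
  obtain ⟨b, hb⟩ := Option.ne_none_iff_exists'.mp hi
  obtain ⟨c, hc⟩ := Option.ne_none_iff_exists'.mp hj
  refine ⟨a, b, c, ha, hb, hc, ?_, ?_, ?_⟩
  · rintro rfl; exact hf.spine_ne_r ha hb
  · rintro rfl; exact hf.spine_ne_r ha hc
  · rintro rfl; exact hij (hb.trans hc.symm)

section FourColors

variable {f g : FanVertex → Option (Fin 4)}

/-- Bob completes the colors around `spine (a + 1)`. -/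
theorem IsPosition.not_alice_of_gap_two (hf : IsPosition f) {a : ℕ} (ha : a + 2 < 49)
    (h₀ : f (spine a) ≠ none) (h₁ : f (spine (a + 1)) = none) (h₂ : f (spine (a + 2)) ≠ none)
    (hne : f (spine a) ≠ f (spine (a + 2)))
    (hear : f (ear a) = none ∨ f (ear (a + 1)) = none) :
    ¬ AliceWinsColoring fanGraph 4 .bob f := by
  obtain ⟨x, y, z, hx, hy, hz, hxy, hxz, hyz⟩ := hf.exists_colors h₀ h₂ hne
  obtain ⟨d, hdx, hdy, hdz⟩ := exists_fourth x y z
  -- Whichever ear at `spine (a + 1)` is free, Bob gives it the fourth color `d`.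
  have key : ∀ j, j < 48 → f (ear j) = none → fanGraph.Adj (spine (a + 1)) (ear j) →
      (f (spine j) ≠ some d ∧ f (spine (j + 1)) ≠ some d ∧
        (f (spine j) ≠ none ∨ f (spine (j + 1)) ≠ none)) →
      ¬ AliceWinsColoring fanGraph 4 .bob f := by
    intro j hj hnone hadj ⟨hc₁, hc₂, hs⟩
    refine not_aliceWinsColoring_bob (hf.ear_move hj hnone hc₁ hc₂ hs).1 ?_
    refine not_alice_of_four (x := spine (a + 1)) (u₁ := r) (u₂ := spine a)
      (u₃ := spine (a + 2)) (u₄ := ear j) (a := x) (b := y) (c := z) (d := d) le_rfl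
      (by simpa using h₁) (by simp) (adj_spine_succ (by omega)).symm
      (adj_spine_succ (by omega)) hadj (by simpa using hx) (by simpa using hy)
      (by simpa using hz) (by simp) ?_
    simp [hxy, hxz, hyz, hdx.symm, hdy.symm, hdz.symm]
  rcases hear with h | h
  · exact key a (by omega) h (adj_spine_succ_ear (by omega))
      ⟨by rw [hy]; simpa using hdy.symm, by simp [h₁], Or.inl h₀⟩
  · exact key (a + 1) (by omega) h (adj_spine_ear (by omega))
      ⟨by simp [h₁], by rw [hz]; simpa using hdz.symm, Or.inr h₂⟩

/-- On his turn, Bob wins if there are two colored vertices of the path at an even distance of at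
least `4` with only uncolored ones between them. -/
theorem IsPosition.not_alice_of_even_gap (n : ℕ) : ∀ {f : FanVertex → Option (Fin 4)} {a : ℕ},
    IsPosition f → a + 2 * n + 4 < 49 → f (spine a) ≠ none → f (spine (a + 2 * n + 4)) ≠ none →
    (∀ i, a < i → i < a + 2 * n + 4 → f (spine i) = none) →
    ¬ AliceWinsColoring fanGraph 4 .bob f := by
  induction n using Nat.strong_induction_on with
  | _ n ih =>
  intro f a hf ha h₀ hb hgap
  obtain ⟨x, hx⟩ := Option.ne_none_iff_exists'.mp hf.r_ne
  obtain ⟨y, hy⟩ := Option.ne_none_iff_exists'.mp h₀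
  obtain ⟨z, hz⟩ := Option.ne_none_iff_exists'.mp hb
  -- Bob plays `d` at `spine (a + 2)`, threatening `spine (a + 1)`. Avoiding `z` matters only in the
  -- shortest gap, where a second threat arises at `spine (a + 3)`.
  obtain ⟨d, hdx, hdy, hdz⟩ := exists_fourth x y z
  have h1 := hgap (a + 1) (by omega) (by omega)
  have h2 := hgap (a + 2) (by omega) (by omega)
  have h3 := hgap (a + 3) (by omega) (by omega)
  have e1 := hf.ear_eq_none (show a + 1 < 48 by omega) h1 h2
  have e2 := hf.ear_eq_none (show a + 2 < 48 by omega) h2 h3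
  obtain ⟨hmove, hg⟩ := hf.spine_move (i := a + 2) (c := d) (by omega) h2
    (by rw [hx]; simpa using hdx.symm)
    (by rintro j hj (h | rfl)
        · obtain rfl : j = a + 1 := by omega
          simp [h1]
        · simp [h3])
    (by rintro j hj (h | rfl)
        · obtain rfl : j = a + 1 := by omega
          simp [e1]
        · simp [e2])
  refine not_aliceWinsColoring_bob hmove ?_
  set g := Function.update f (spine (a + 2)) (some d) with hgdef
  have gf : ∀ i < 49, i ≠ a + 2 → g (spine i) = f (spine i) := fun i hi h => by
    rw [hgdef, Function.update_of_ne (by rwa [Ne, spine_inj hi (by omega)])]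
  have g0 : g (spine a) = some y := by rw [gf _ (by omega) (by omega), hy]
  have g1 : g (spine (a + 1)) = none := by rw [gf _ (by omega) (by omega), h1]
  have g2 : g (spine (a + 2)) = some d := by simp [hgdef]
  have gb : g (spine (a + 2 * n + 4)) = some z := by rw [gf _ (by omega) (by omega), hz]
  have ge1 : g (ear (a + 1)) = none := by simp [hgdef, e1]
  have ge2 : g (ear (a + 2)) = none := by simp [hgdef, e2]
  refine not_aliceWinsColoring_alice g1 fun h hgh => ?_
  obtain ⟨v, c, hv, rfl, hh⟩ := hg.exists_eq_update hgh
  have keep : ∀ {u}, g u ≠ none → Function.update g v (some c) u = g u := fun hu =>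
    Function.update_of_ne (by rintro rfl; exact hu hv) _ _
  -- Only these two vertices can parry the threat, and coloring either leaves the part of the gap
  -- right of `spine (a + 2)` untouched, shorter by two.
  by_cases hcase : v = spine (a + 1) ∨ v = ear (a + 1)
  · have hgap' : ∀ i, a + 2 < i → i < a + 2 * n + 4 →
        Function.update g v (some c) (spine i) = none := by
      intro i hi hi'
      rw [Function.update_of_ne, gf _ (by omega) (by omega)]
      · exact hgap i (by omega) (by omega)
      · rcases hcase with rfl | rfl
        · rw [Ne, spine_inj (by omega) (by omega)]
          omega
        · simp
    rcases n with _ | n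
    · refine hh.not_alice_of_gap_two (a := a + 2) (by omega) (by rw [keep] <;> simp [g2])
        (hgap' _ (by omega) (by omega)) (by rw [keep] <;> simp [gb])
        (by rw [keep, keep] <;> simp [g2, gb, hdz]) (Or.inl ?_)
      rw [Function.update_of_ne, ge2]
      rcases hcase with rfl | rfl
      · simp
      · rw [Ne, ear_inj (by omega) (by omega)]
        omega
    · rw [show a + 2 * (n + 1) + 4 = a + 2 + 2 * n + 4 by ring] at gb hgap'
      exact ih n (by omega) hh (by omega) (by rw [keep] <;> simp [g2])
        (by rw [keep] <;> simp [gb]) hgap'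
  · push Not at hcase
    refine hh.not_alice_of_gap_two (a := a) (by omega) (by rw [keep] <;> simp [g0]) ?_
      (by rw [keep] <;> simp [g2]) (by rw [keep, keep] <;> simp [g2, g0, hdy.symm]) (Or.inr ?_)
    · rw [Function.update_of_ne hcase.1.symm, g1]
    · rw [Function.update_of_ne hcase.2.symm, ge1]

end FourColors

end fanGraph

/-! ### The reflection of the path -/

namespace FanVertex

/-- The reflection of the graph, as a map. -/
def reflect : FanVertex → FanVertex
  | r => r
  | w i => w i.rev
  | v j => v j.rev

theorem reflect_reflect (u : FanVertex) : u.reflect.reflect = u := by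
  cases u <;> simp [reflect]

@[simp] theorem reflect_r : reflect r = r := rfl

theorem reflect_spine {i : ℕ} (hi : i < 49) : reflect (spine i) = spine (48 - i) := by
  simp only [reflect, spine, w.injEq, Fin.ext_iff, Fin.val_rev, Fin.val_ofNat]
  omega

theorem reflect_ear {j : ℕ} (hj : j < 48) : reflect (ear j) = ear (47 - j) := by
  simp only [reflect, ear, v.injEq, Fin.ext_iff, Fin.val_rev, Fin.val_ofNat]
  omega

theorem exists_forall_spine_ne (u : FanVertex) : ∃ y, ∀ i < 49, i ≠ y → spine i ≠ u := by
  rcases eq_r_or_spine_or_ear u with rfl | ⟨l, hl, rfl⟩ | ⟨j, hj, rfl⟩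
  · exact ⟨0, by simp⟩
  · exact ⟨l, fun i hi h => by rwa [Ne, spine_inj hi hl]⟩
  · exact ⟨0, by simp⟩

end FanVertex

namespace fanGraph

theorem reflect_adj {u v : FanVertex} (h : fanGraph.Adj u v) :
    fanGraph.Adj u.reflect v.reflect := by
  cases u <;> cases v <;>
    simp only [fanGraph, SimpleGraph.fromRel_adj, FanEdge, reflect, Fin.ext_iff, Fin.val_rev,
      Fin.val_castSucc, Fin.val_succ, ne_eq, w.injEq, v.injEq, not_false_eq_true, reduceCtorEq,
      or_false, false_or, or_true, and_self, and_false, true_and] at h ⊢ <;> omega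

/-- The automorphism of the graph that reverses the path. -/
def reflection : fanGraph ≃g fanGraph where
  toFun := reflect
  invFun := reflect
  left_inv := reflect_reflect
  right_inv := reflect_reflect
  map_rel_iff' {u v} :=
    ⟨fun h => by simpa [reflect_reflect] using reflect_adj h, fun h => reflect_adj h⟩

@[simp] theorem reflection_apply (u : FanVertex) : reflection u = u.reflect := rfl

theorem IsPosition.comp_reflection {k : ℕ} {f : FanVertex → Option (Fin k)} (hf : IsPosition f) :
    IsPosition (f ∘ reflection) := by
  refine ⟨hf.r_ne, fun j hj h => ?_, fun u v huv => hf.proper _ _ (reflect_adj huv)⟩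
  simp only [Function.comp_apply, reflection_apply, reflect_ear hj,
    reflect_spine (show j < 49 by omega), reflect_spine (show j + 1 < 49 by omega)] at h ⊢
  have := hf.support (47 - j) (by omega) h
  rw [show 47 - j + 1 = 48 - j by omega] at this
  rw [show 48 - (j + 1) = 47 - j by omega]
  exact this.symm

/-! ### Odd gaps and long uncolored runs -/

section FourColors

variable {f g : FanVertex → Option (Fin 4)}

/-- On his turn, Bob wins if there are two colored vertices of the path at an odd distance of at
least `7` with only uncolored ones between them, and the first `ear` between them is uncolored. -/
theorem IsPosition.not_alice_of_odd_gap (hf : IsPosition f) {a n : ℕ} (ha : a + 2 * n + 7 < 49)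
    (h₀ : f (spine a) ≠ none) (hb : f (spine (a + 2 * n + 7)) ≠ none)
    (hgap : ∀ i, a < i → i < a + 2 * n + 7 → f (spine i) = none) (hear : f (ear a) = none) :
    ¬ AliceWinsColoring fanGraph 4 .bob f := by
  obtain ⟨x, hx⟩ := Option.ne_none_iff_exists'.mp hf.r_ne
  obtain ⟨y, hy⟩ := Option.ne_none_iff_exists'.mp h₀
  obtain ⟨z, hz⟩ := Option.ne_none_iff_exists'.mp hb
  have hxy : x ≠ y := by rintro rfl; exact hf.spine_ne_r hx hy
  -- After Bob plays `c` at `ear a`, the vertex `spine (a + 1)` sees `x`, `y`, `c`; it is lost as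
  -- soon as some neighbor gets the last color `d`.
  obtain ⟨c, hcx, hcy, -⟩ := exists_fourth x y y
  obtain ⟨d, hdx, hdy, hdc⟩ := exists_fourth x y c
  have f1 := hgap (a + 1) (by omega) (by omega)
  have f2 := hgap (a + 2) (by omega) (by omega)
  have f3 := hgap (a + 3) (by omega) (by omega)
  obtain ⟨hmove, hg⟩ := hf.ear_move (j := a) (c := c) (by omega) hear
    (by rw [hy]; simpa using hcy.symm) (by simp [f1]) (Or.inl h₀)
  refine not_aliceWinsColoring_bob hmove ?_
  set g := Function.update f (ear a) (some c) with hgdef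
  have gf : ∀ i, g (spine i) = f (spine i) := fun i => by simp [hgdef]
  have gr : g r = some x := by simp [hgdef, hx]
  have ge : g (ear a) = some c := by simp [hgdef]
  refine not_aliceWinsColoring_alice (x := spine (a + 1)) (by rw [gf, f1]) fun h hgh => ?_
  obtain ⟨v, e, hv, rfl, hh⟩ := hg.exists_eq_update hgh
  have keep : ∀ {u} {o}, g u = some o → Function.update g v (some e) u = some o := fun hu => by
    rw [Function.update_of_ne (by rintro rfl; simp [hv] at hu), hu]
  have free : ∀ i, a < i → i < a + 2 * n + 7 → spine i ≠ v →
      Function.update g v (some e) (spine i) = none := fun i hi hi' hne => by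
    rw [Function.update_of_ne hne, gf, hgap i hi hi']
  have dead : ∀ {p} {h : FanVertex → Option (Fin 4)}, h r = some x → h (spine a) = some y →
      h (ear a) = some c → h (spine (a + 1)) = none →
      ∀ u, fanGraph.Adj (spine (a + 1)) u → h u = some d →
      ¬ AliceWinsColoring fanGraph 4 p h := by
    intro p h hr ha' he h1 u hu hud
    refine not_alice_of_four le_rfl h1 (adj_spine_r _) (adj_spine_succ (by omega)).symm
      (adj_spine_succ_ear (by omega)) hu hr ha' he hud ?_
    simp [hxy, hcx.symm, hcy.symm, hdx.symm, hdy.symm, hdc.symm]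
  have hr := keep gr
  have hs := keep ((gf a).trans hy)
  have he := keep ge
  -- Rescuing the threatened vertex leaves an even gap of length `2 * n + 6`.
  by_cases hv1 : v = spine (a + 1)
  · have hb' := keep ((gf _).trans hz)
    have hgap' : ∀ i, a + 1 < i → i < a + 2 * n + 7 →
        Function.update g v (some e) (spine i) = none := fun i hi hi' =>
      free i (by omega) hi' (by rw [hv1, Ne, spine_inj (by omega) (by omega)]; omega)
    rw [show a + 2 * n + 7 = a + 1 + 2 * (n + 1) + 4 by ring] at hb' hgap'
    exact hh.not_alice_of_even_gap (n + 1) (a := a + 1) (by omega) (by simp [hv1])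
      (by simp [hb']) hgap'
  have h1 := free (a + 1) (by omega) (by omega) (Ne.symm hv1)
  by_cases hv2 : v = spine (a + 2)
  · by_cases hed : e = d
    · exact dead hr hs he h1 (spine (a + 2)) (adj_spine_succ (by omega)) (by simp [hv2, hed])
    -- With another color at `spine (a + 2)`, its ear `ear (a + 1)` has become available, and Bob
    -- puts `d` there.
    · obtain ⟨hmove', -⟩ := hh.ear_move (j := a + 1) (c := d) (by omega)
        (by rw [Function.update_of_ne (by simp [hv2])]
            exact hg.ear_eq_none (by omega) (by rw [gf, f1]) (by rw [gf, f2]))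
        (by simp [h1]) (by simp [hv2, hed]) (Or.inr (by simp [hv2]))
      refine not_aliceWinsColoring_bob hmove' (dead ?_ ?_ ?_ ?_ (ear (a + 1))
        (adj_spine_ear (by omega)) (by simp))
      · rw [Function.update_of_ne (by simp), hr]
      · rw [Function.update_of_ne (by simp), hs]
      · rw [Function.update_of_ne (by rw [Ne, ear_inj (by omega) (by omega)]; omega), he]
      · rw [Function.update_of_ne (by simp), h1]
  have h2 := free (a + 2) (by omega) (by omega) (Ne.symm hv2)
  -- The only other way to keep `d` away from `spine (a + 2)`. It leaves an even gap of length `2 *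
  -- n + 4`; hence the minimal odd length 7.
  by_cases hv3 : v = spine (a + 3) ∧ e = d
  · have hb' := keep ((gf _).trans hz)
    have hgap' : ∀ i, a + 3 < i → i < a + 2 * n + 7 →
        Function.update g v (some e) (spine i) = none := fun i hi hi' =>
      free i (by omega) hi' (by rw [hv3.1, Ne, spine_inj (by omega) (by omega)]; omega)
    rw [show a + 2 * n + 7 = a + 3 + 2 * n + 4 by ring] at hb' hgap'
    exact hh.not_alice_of_even_gap n (a := a + 3) (by omega) (by simp [hv3.1])
      (by simp [hb']) hgap'
  obtain ⟨h3, he2⟩ : Function.update g v (some e) (spine (a + 3)) ≠ some d ∧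
      Function.update g v (some e) (ear (a + 2)) = none := by
    by_cases hv3' : v = spine (a + 3)
    · refine ⟨fun h => hv3 ⟨hv3', by simpa [hv3'] using h⟩, ?_⟩
      rw [Function.update_of_ne (by simp [hv3'])]
      exact hg.ear_eq_none (by omega) (by rw [gf, f2]) (by rw [gf, f3])
    · have h3 := free (a + 3) (by omega) (by omega) (Ne.symm hv3')
      exact ⟨by simp [h3], hh.ear_eq_none (by omega) h2 h3⟩
  have he1 := hh.ear_eq_none (show a + 1 < 48 by omega) h1 h2
  obtain ⟨hmove', -⟩ := hh.spine_move (i := a + 2) (c := d) (by omega) h2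
    (by rw [hr]; simpa using hdx.symm)
    (by rintro j hj (h | rfl)
        · obtain rfl : j = a + 1 := by omega
          simp [h1]
        · exact h3)
    (by rintro j hj (h | rfl)
        · obtain rfl : j = a + 1 := by omega
          simp [he1]
        · simp [he2])
  refine not_aliceWinsColoring_bob hmove' (dead ?_ ?_ ?_ ?_ (spine (a + 2))
    (adj_spine_succ (by omega)) (by simp))
  · rw [Function.update_of_ne (by simp), hr]
  · rw [Function.update_of_ne (by rw [Ne, spine_inj (by omega) (by omega)]; omega), hs]
  · rw [Function.update_of_ne (by simp), he]
  · rw [Function.update_of_ne (by rw [Ne, spine_inj (by omega) (by omega)]; omega), h1]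

/-- The mirror image of the preceding lemma, needed when only the ear at the right end is known to
be uncolored. -/
theorem IsPosition.not_alice_of_odd_gap' (hf : IsPosition f) {a n : ℕ} (ha : a + 2 * n + 7 < 49)
    (h₀ : f (spine a) ≠ none) (hb : f (spine (a + 2 * n + 7)) ≠ none)
    (hgap : ∀ i, a < i → i < a + 2 * n + 7 → f (spine i) = none)
    (hear : f (ear (a + 2 * n + 6)) = none) :
    ¬ AliceWinsColoring fanGraph 4 .bob f := by
  intro h
  refine hf.comp_reflection.not_alice_of_odd_gap (a := 48 - (a + 2 * n + 7)) (n := n) (by omega)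
    ?_ ?_ ?_ ?_ (h.comp_iso reflection)
  · rw [Function.comp_apply, reflection_apply, reflect_spine (by omega)]
    rwa [show 48 - (48 - (a + 2 * n + 7)) = a + 2 * n + 7 by omega]
  · rw [Function.comp_apply, reflection_apply, reflect_spine (by omega)]
    rwa [show 48 - (48 - (a + 2 * n + 7) + 2 * n + 7) = a by omega]
  · intro i hi hi'
    rw [Function.comp_apply, reflection_apply, reflect_spine (by omega)]
    exact hgap _ (by omega) (by omega)
  · rw [Function.comp_apply, reflection_apply, reflect_ear (by omega)]
    rwa [show 47 - (48 - (a + 2 * n + 7)) = a + 2 * n + 6 by omega]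

theorem exists_fourth_option (a b c : Option (Fin 4)) :
    ∃ d, a ≠ some d ∧ b ≠ some d ∧ c ≠ some d := by
  revert a b c; decide

/-- On his turn, Bob wins if a colored vertex of the path is followed by `12` uncolored ones. -/
theorem IsPosition.not_alice_of_run_four (hf : IsPosition f) {a : ℕ} (ha : a + 12 < 49)
    (h₀ : f (spine a) ≠ none) (hrun : ∀ i, a < i → i ≤ a + 12 → f (spine i) = none) :
    ¬ AliceWinsColoring fanGraph 4 .bob f := by
  -- The vertex and the ear just beyond the run may be colored. If `a + 12 = 48`, their indices wrap
  -- around, which only makes Bob avoid more colors.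
  obtain ⟨d, hd, hds, hde⟩ :=
    exists_fourth_option (f r) (f (spine (a + 12 + 1))) (f (ear (a + 12)))
  obtain ⟨hmove, hg⟩ := hf.spine_move (i := a + 12) (c := d) ha (hrun _ (by omega) le_rfl) hd
    (by rintro j hj (h | rfl)
        · simp [hrun j (by omega) (by omega)]
        · exact hds)
    (by rintro j hj (h | rfl)
        · simp [hf.ear_eq_none hj (hrun j (by omega) (by omega))
            (hrun (j + 1) (by omega) (by omega))]
        · exact hde)
  refine not_aliceWinsColoring_bob hmove ?_
  set g := Function.update f (spine (a + 12)) (some d) with hgdef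
  have gf : ∀ i < 49, i ≠ a + 12 → g (spine i) = f (spine i) := fun i hi h => by
    rw [hgdef, Function.update_of_ne (by rwa [Ne, spine_inj hi ha])]
  have g0 : g (spine a) ≠ none := by rwa [gf a (by omega) (by omega)]
  have gb : g (spine (a + 12)) ≠ none := by simp [hgdef]
  have ggap : ∀ i, a < i → i < a + 12 → g (spine i) = none := fun i hi hi' => by
    rw [gf i (by omega) (by omega), hrun i hi hi'.le]
  refine not_aliceWinsColoring_alice (ggap (a + 1) (by omega) (by omega)) fun h hgh => ?_
  obtain ⟨v, e, hv, rfl, hh⟩ := hg.exists_eq_update hgh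
  have hgap : ∀ i, a < i → i < a + 12 → spine i ≠ v →
      Function.update g v (some e) (spine i) = none := fun i hi hi' hne => by
    rw [Function.update_of_ne hne, ggap i hi hi']
  by_cases hm : ∃ m, a < m ∧ m < a + 12 ∧ v = spine m
  · obtain ⟨m, hm, hm', rfl⟩ := hm
    have hgap : ∀ i, a < i → i < a + 12 → i ≠ m →
        Function.update g (spine m) (some e) (spine i) = none := fun i hi hi' hne =>
      hgap i hi hi' (by rwa [Ne, spine_inj (by omega) (by omega)])
    have hear : ∀ j, a < j → j + 1 < a + 12 →
        Function.update g (spine m) (some e) (ear j) = none := fun j hj hj' => by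
      rw [Function.update_of_ne (by simp)]
      exact hg.ear_eq_none (by omega) (ggap j hj (by omega)) (ggap _ (by omega) hj')
    have hsm : Function.update g (spine m) (some e) (spine m) ≠ none := by simp
    -- The two pieces have total length 12, so one has length at least 6: either even and at least
    -- 4, or odd and at least 7. In the odd case the ear next to `spine m` is used, as it lies in
    -- the old gap and is therefore uncolored.
    rcases le_or_gt (a + 6) m with h6 | h6
    · obtain ⟨n, rfl | rfl⟩ : ∃ n, m = a + 2 * n + 4 ∨ m = a + 2 * n + 7 := by
        rcases Nat.even_or_odd' (m - a) with ⟨n, hn | hn⟩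
        · exact ⟨n - 2, by omega⟩
        · exact ⟨n - 3, by omega⟩
      · exact hh.not_alice_of_even_gap n (by omega) (update_ne_none g0) hsm
          fun i hi hi' => hgap i hi (by omega) (by omega)
      · exact hh.not_alice_of_odd_gap' (by omega) (update_ne_none g0) hsm
          (fun i hi hi' => hgap i hi (by omega) (by omega)) (hear _ (by omega) (by omega))
    · obtain ⟨n, hn | hn⟩ : ∃ n, a + 12 = m + 2 * n + 4 ∨ a + 12 = m + 2 * n + 7 := by
        rcases Nat.even_or_odd' (a + 12 - m) with ⟨n, hn | hn⟩
        · exact ⟨n - 2, by omega⟩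
        · exact ⟨n - 3, by omega⟩
      · exact hh.not_alice_of_even_gap n (by omega) hsm (by rw [← hn]; exact update_ne_none gb)
          fun i hi hi' => hgap i (by omega) (by omega) (by omega)
      · exact hh.not_alice_of_odd_gap (n := n) (by omega) hsm
          (by rw [← hn]; exact update_ne_none gb)
          (fun i hi hi' => hgap i (by omega) (by omega) (by omega)) (hear _ (by omega) (by omega))
  · push Not at hm
    -- The gap is intact and has length `12 = 2 * 4 + 4`.
    exact hh.not_alice_of_even_gap 4 ha (update_ne_none g0) (update_ne_none gb)
      fun i hi hi' => hgap i hi hi' (hm i hi hi').symm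

end FourColors

/-- Bob gives `spine (a + 2)` the color missing from `r` and `spine a`; then `spine (a + 1)` sees
all three colors. The third uncolored vertex ensures that this move is legal. -/
theorem IsPosition.not_alice_of_run_three {f : FanVertex → Option (Fin 3)} (hf : IsPosition f)
    {a : ℕ} (ha : a + 3 < 49) (h₀ : f (spine a) ≠ none)
    (hrun : ∀ i, a < i → i ≤ a + 3 → f (spine i) = none) :
    ¬ AliceWinsColoring fanGraph 3 .bob f := by
  obtain ⟨x, hx⟩ := Option.ne_none_iff_exists'.mp hf.r_ne
  obtain ⟨y, hy⟩ := Option.ne_none_iff_exists'.mp h₀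
  have hxy : x ≠ y := by rintro rfl; exact hf.spine_ne_r hx hy
  obtain ⟨d, hdx, hdy, hall⟩ : ∃ d, d ≠ x ∧ d ≠ y ∧ ∀ c, c = x ∨ c = y ∨ c = d := by
    clear hx hy
    revert x y; decide
  have h1 := hrun (a + 1) (by omega) (by omega)
  have h2 := hrun (a + 2) (by omega) (by omega)
  have h3 := hrun (a + 3) (by omega) (by omega)
  obtain ⟨hmove, hg⟩ := hf.spine_move (i := a + 2) (c := d) (by omega) h2
    (by rw [hx]; simpa using hdx.symm)
    (by rintro j hj h
        simp [hrun j (by omega) (by omega)])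
    (by rintro j hj h
        simp [hf.ear_eq_none hj (hrun j (by omega) (by omega))
            (hrun (j + 1) (by omega) (by omega))])
  refine not_aliceWinsColoring_bob hmove
    (not_aliceWinsColoring_of_sees_all (x := spine (a + 1)) ?_ fun c => ?_)
  · rwa [Function.update_of_ne (by rw [Ne, spine_inj (by omega) (by omega)]; omega)]
  · rcases hall c with rfl | rfl | rfl
    · exact ⟨r, adj_spine_r _, by simpa using hx⟩
    · refine ⟨spine a, (adj_spine_succ (by omega)).symm, ?_⟩
      rwa [Function.update_of_ne (by rw [Ne, spine_inj (by omega) (by omega)]; omega)]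
    · exact ⟨spine (a + 2), adj_spine_succ (by omega), by simp⟩

/-! ### The opening moves -/

section

variable {k : ℕ} {f : FanVertex → Option (Fin k)}

theorem IsPosition.not_alice_of_run (hk : 3 ≤ k) (hk' : k ≤ 4) (hf : IsPosition f) {a : ℕ}
    (ha : a + 12 < 49) (h₀ : f (spine a) ≠ none)
    (hrun : ∀ i, a < i → i ≤ a + 12 → f (spine i) = none) :
    ¬ AliceWinsColoring fanGraph k .bob f := by
  obtain rfl | rfl : k = 3 ∨ k = 4 := by omega
  · exact hf.not_alice_of_run_three (by omega) h₀ fun i hi hi' => hrun i hi (by omega)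
  · exact hf.not_alice_of_run_four ha h₀ hrun

/-- On his turn, Bob wins if a vertex in the first half of the path is colored and at most one
later vertex of the path is. -/
theorem IsPosition.not_alice_of_first_half (hk : 3 ≤ k) (hk' : k ≤ 4) (hf : IsPosition f)
    {s : ℕ} (hs : s ≤ 24) (h₀ : f (spine s) ≠ none) (y : ℕ)
    (hfree : ∀ i, s < i → i < 49 → i ≠ y → f (spine i) = none) :
    ¬ AliceWinsColoring fanGraph k .bob f := by
  -- A late colored vertex within distance 12 of `s` itself starts a run; otherwise `s` does. The
  -- bound needed is `24 + 12 + 12 = 48`.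
  by_cases hy : s < y ∧ y ≤ s + 12 ∧ f (spine y) ≠ none
  · exact hf.not_alice_of_run hk hk' (a := y) (by omega) hy.2.2
      fun i hi hi' => hfree i (by omega) (by omega) (by omega)
  · refine hf.not_alice_of_run hk hk' (a := s) (by omega) h₀ fun i hi hi' => ?_
    by_cases hiy : i = y
    · subst hiy
      by_contra h
      exact hy ⟨hi, hi', h⟩
    · exact hfree i hi (by omega) hiy

theorem exists_third (hk : 3 ≤ k) (a b : Fin k) : ∃ c, c ≠ a ∧ c ≠ b := by
  have : ({a, b} : Finset (Fin k)).card < Fintype.card (Fin k) := by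
    rw [Fintype.card_fin]
    exact lt_of_le_of_lt Finset.card_le_two hk
  obtain ⟨c, hc⟩ := Finset.exists_mem_notMem_of_card_lt_card
    (s := {a, b}) (t := Finset.univ) (by simpa using this)
  exact ⟨c, by simpa using hc.2⟩

/-- After his own move, Bob wins if a vertex in the first half of the path is colored and no later
one is. -/
theorem IsPosition.not_alice_of_first_half' (hk : 3 ≤ k) (hk' : k ≤ 4) (hf : IsPosition f)
    {s : ℕ} (hs : s ≤ 24) (h₀ : f (spine s) ≠ none)
    (hfree : ∀ i, s < i → i < 49 → f (spine i) = none) :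
    ¬ AliceWinsColoring fanGraph k .alice f := by
  refine not_aliceWinsColoring_alice (hfree (s + 1) (by omega) (by omega)) fun g hg => ?_
  obtain ⟨v, c, hv, rfl, hg'⟩ := hf.exists_eq_update hg
  obtain ⟨y, hy⟩ := exists_forall_spine_ne v
  refine hg'.not_alice_of_first_half hk hk' hs (update_ne_none h₀) y fun i hi hi' hiy => ?_
  rw [Function.update_of_ne (hy i hi' hiy), hfree i hi hi']

theorem not_alice_after_r (hk : 3 ≤ k) (hk' : k ≤ 4) (c : Fin k) :
    ¬ AliceWinsColoring fanGraph k .bob (Function.update (fun _ => none) r (some c)) := by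
  obtain ⟨d, hd, -⟩ := exists_third hk c c
  have hf : IsPosition (Function.update (fun _ => none) r (some c)) :=
    ⟨by simp, by simp, proper_update (by simp) (by simp)⟩
  obtain ⟨hmove, hg⟩ := hf.spine_move (i := 24) (c := d) (by omega) (by simp)
    (by simpa using hd.symm) (by simp) (by simp)
  refine not_aliceWinsColoring_bob hmove
    (hg.not_alice_of_first_half' hk hk' (s := 24) le_rfl (by simp) fun i hi hi' => ?_)
  rw [Function.update_of_ne (by rw [Ne, spine_inj (by omega) (by omega)]; omega)]
  simp

theorem not_alice_after_spine (hk : 3 ≤ k) (hk' : k ≤ 4) {i : ℕ} (hi : i ≤ 24) (c : Fin k) :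
    ¬ AliceWinsColoring fanGraph k .bob (Function.update (fun _ => none) (spine i) (some c)) := by
  obtain ⟨d, hd, -⟩ := exists_third hk c c
  obtain ⟨hmove, hg⟩ := isColoringMove_update_of_support
    (f := Function.update (fun _ => none) (spine i) (some c)) (x := r) (c := d) (by simp)
    (fun u _ => by
      by_cases hu : u = spine i
      · simpa [hu] using hd.symm
      · simp [hu])
    (proper_update (by simp) (by simp)) (by simp) (by simp)
  refine not_aliceWinsColoring_bob hmove
    (hg.not_alice_of_first_half' hk hk' hi (by simp) fun j hj hj' => ?_)
  rw [Function.update_of_ne (by simp),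
    Function.update_of_ne (by rw [Ne, spine_inj (by omega) (by omega)]; omega)]

/-- Here `r` is not adjacent to the first vertex, so Bob colors `spine j` at once and `r` a move
later, unless Alice colors `r` in between. -/
theorem not_alice_after_ear (hk : 3 ≤ k) (hk' : k ≤ 4) {j : ℕ} (hj : j ≤ 23) (c : Fin k) :
    ¬ AliceWinsColoring fanGraph k .bob (Function.update (fun _ => none) (ear j) (some c)) := by
  obtain ⟨d, hd, -⟩ := exists_third hk c c
  have hlegal : ∀ u, fanGraph.Adj (spine j) u →
      Function.update (fun _ => none) (ear j) (some c) u ≠ some d := fun u _ => by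
    by_cases hu : u = ear j
    · simpa [hu] using hd.symm
    · simp [hu]
  have hmove : IsColoringMove fanGraph (Function.update (fun _ => none) (ear j) (some c))
      (Function.update (Function.update (fun _ => none) (ear j) (some c)) (spine j) (some d)) := by
    refine isColoringMove_update (by simp) hlegal ?_
    have hcolored : ({u | (fun _ => none : FanVertex → Option (Fin k)) u ≠ none} : Set _) = ∅ := by
      simp
    rw [setOf_update_ne_none, hcolored, LawfulSingleton.insert_empty_eq]
    exact SimpleGraph.induce_pair_connected_of_adj (adj_spine_ear (show j < 48 by omega))
  have hproper := proper_update (proper_update (G := fanGraph) (f := fun _ => none) (by simp)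
    (x := ear j) (d := c) (by simp)) hlegal
  refine not_aliceWinsColoring_bob hmove ?_
  set g := Function.update (Function.update (fun _ => none) (ear j) (some c)) (spine j) (some d)
    with hgdef
  have gs : g (spine j) = some d := by simp [hgdef]
  have ge : g (ear j) = some c := by simp [hgdef]
  have gother : ∀ u, u ≠ spine j → u ≠ ear j → g u = none := fun u h₁ h₂ => by
    simp [hgdef, h₁, h₂]
  have gfree : ∀ i < 49, i ≠ j → g (spine i) = none := fun i hi hij =>
    gother _ (by rwa [Ne, spine_inj hi (by omega)]) (by simp)
  refine not_aliceWinsColoring_alice (gother r (by simp) (by simp)) fun h hgh => ?_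
  obtain ⟨v, e, hv, hve, rfl, hconn⟩ := hgh.eq_update
  have hproper' := proper_update hproper hve
  have hsupp : ∀ i < 48, Function.update g v (some e) (ear i) ≠ none →
      Function.update g v (some e) (spine i) ≠ none ∨
      Function.update g v (some e) (spine (i + 1)) ≠ none := fun i hi h =>
    support_of_connected hconn (x := spine j) (y := ear j) (by simp)
      (update_ne_none (by simp [gs])) (update_ne_none (by simp [ge])) hi h
  by_cases hvr : v = r
  -- No later spine vertex is colored, so the exceptional index 0 is a dummy.
  · refine IsPosition.not_alice_of_first_half hk hk' (s := j) (f := Function.update g v (some e))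
      ⟨by simp [hvr], hsupp, hproper'⟩ (by omega) (update_ne_none (by simp [gs])) 0 fun i hi hi' _ => ?_
    rw [Function.update_of_ne (by simp [hvr]), gfree i hi' (by omega)]
  -- The colored spine vertices carry only `d` and possibly `e`, so a third color is legal at `r`.
  obtain ⟨t, htd, hte⟩ := exists_third hk d e
  obtain ⟨hmove', hh⟩ := isColoringMove_update_of_support
    (f := Function.update g v (some e)) (x := r) (c := t)
    (by rw [Function.update_of_ne (Ne.symm hvr), gother r (by simp) (by simp)])
    (fun u hu => by
      obtain ⟨i, hi, rfl⟩ := eq_spine_of_adj_r hu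
      by_cases hiv : spine i = v
      · simpa [hiv] using hte.symm
      rw [Function.update_of_ne hiv]
      by_cases hij : i = j
      · simpa [hij, gs] using htd.symm
      · simp [gfree i hi hij])
    hproper' (by simp) (fun i hi h => (hsupp i hi (by simpa using h)).imp update_ne_none
      update_ne_none)
  refine not_aliceWinsColoring_bob hmove' ?_
  -- While `r` is uncolored, connectedness forces a spine vertex chosen by Alice to be next to
  -- `spine j`.
  have hspine : ∀ i < 49, v = spine i → i + 1 = j ∨ i = j + 1 := by
    rintro i hi rfl
    have : Nontrivial {u | Function.update g (spine i) (some e) u ≠ none} :=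
      ⟨⟨spine i, by simp⟩, ⟨ear j, update_ne_none (by simp [ge])⟩, by simp⟩
    obtain ⟨⟨x, hx⟩, hadj⟩ := hconn.preconnected.exists_adj_of_nontrivial ⟨spine i, by simp⟩
    have hadj : fanGraph.Adj (spine i) x := hadj
    have hij : i ≠ j := by rintro rfl; simp [gs] at hv
    have hx : x = spine j ∨ x = ear j := by
      by_contra! hne
      exact hx (by rw [Function.update_of_ne hadj.ne', gother x hne.1 hne.2])
    rcases eq_of_adj_spine hi hadj with rfl | ⟨l, hl, hli, rfl⟩ | ⟨l, hl, hli, rfl⟩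
    · simp at hx
    · have : l = j := by simpa [spine_inj hl (show j < 49 by omega)] using hx
      omega
    · have : l = j := by simpa [ear_inj hl (show j < 48 by omega)] using hx
      omega
  have hfree : ∀ i < 49, i ≠ j → spine i ≠ v →
      Function.update (Function.update g v (some e)) r (some t) (spine i) = none :=
    fun i hi hij hiv => by
      rw [Function.update_of_ne (by simp), Function.update_of_ne hiv, gfree i hi hij]
  -- The last colored spine vertex is `spine (j + 1)` or `spine j`; `j ≤ 23` keeps it in the first
  -- half.
  by_cases hvj : v = spine (j + 1)
  · refine hh.not_alice_of_first_half' hk hk' (s := j + 1) (by omega)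
      (update_ne_none (by simp [hvj])) fun i hi hi' => hfree i hi' (by omega) ?_
    rw [hvj, Ne, spine_inj hi' (by omega)]
    omega
  · refine hh.not_alice_of_first_half' hk hk' (s := j) (by omega)
      (update_ne_none (update_ne_none (by simp [gs]))) fun i hi hi' => hfree i hi' (by omega) ?_
    rintro rfl
    rcases hspine i hi' rfl with h | rfl
    · omega
    · exact hvj rfl

theorem update_none_comp_reflection (u : FanVertex) (c : Fin k) :
    Function.update (fun _ => none) u (some c) ∘ reflection =
      Function.update (fun _ => none) u.reflect (some c) := by
  funext x
  have : x.reflect = u ↔ x = u.reflect :=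
    ⟨fun h => by rw [← h, reflect_reflect], fun h => by rw [h, reflect_reflect]⟩
  simp [Function.update_apply, this]

theorem five_le_of_aliceWinsColoring
    (h : AliceWinsColoring fanGraph k .alice (fun _ => none)) : 5 ≤ k := by
  have hk : 3 ≤ k := by
    obtain ⟨C⟩ := h.colorable (by simp)
    have h₁ := C.valid (adj_r_spine 0)
    have h₂ := C.valid (adj_r_spine 1)
    have h₃ : C (spine 0) ≠ C (spine 1) := C.valid (adj_spine_succ (show 0 < 48 by omega))
    simp only [ne_eq, Fin.ext_iff] at h₁ h₂ h₃
    omega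
  by_contra! hk'
  replace hk' : k ≤ 4 := by omega
  refine not_aliceWinsColoring_alice (x := r) rfl (fun g hg => ?_) h
  obtain ⟨v, c, -, -, rfl, -⟩ := hg.eq_update
  rcases eq_r_or_spine_or_ear v with rfl | ⟨i, hi, rfl⟩ | ⟨j, hj, rfl⟩
  · exact not_alice_after_r hk hk' c
  -- A first move in the second half is reflected into the first.
  · rcases le_or_gt i 24 with hi' | hi'
    · exact not_alice_after_spine hk hk' hi' c
    · intro h
      have := h.comp_iso reflection
      rw [update_none_comp_reflection, reflect_spine hi] at this
      exact not_alice_after_spine hk hk' (by omega) c this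
  · rcases le_or_gt j 23 with hj' | hj'
    · exact not_alice_after_ear hk hk' hj' c
    · intro h
      have := h.comp_iso reflection
      rw [update_none_comp_reflection, reflect_ear hj] at this
      exact not_alice_after_ear hk hk' (by omega) c this

end

theorem connectedGameChromaticNumber_eq : connectedGameChromaticNumber fanGraph = 5 := by
  refine le_antisymm (iInf₂_le (5 : ℕ) (aliceLimitsMarking_five.aliceWinsColoring _ (by simp)))
    (le_iInf₂ fun k hk => ?_)
  exact_mod_cast five_le_of_aliceWinsColoring hk

theorem connectedGameColoringNumber_eq : connectedGameColoringNumber fanGraph = 5 := by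
  refine le_antisymm (iInf₂_le (5 : ℕ) aliceLimitsMarking_five) (le_iInf₂ fun k hk => ?_)
  exact_mod_cast five_le_of_aliceWinsColoring (hk.aliceWinsColoring (fun _ => none) (by simp))

end fanGraph

/-! ### Noncrossing orders give outerplanar drawings -/

/-- The point of the parabola `y = x²` above `x`. -/
noncomputable def parabolaPoint (x : ℝ) : ℂ := ⟨x, x ^ 2⟩

/-- The chord of the parabola `y = x²` between the points above `a` and `b`. -/
noncomputable def parabolaChord (a b : ℝ) (t : unitInterval) : ℂ :=
  ⟨a + t * (b - a), (a + b) * (a + t * (b - a)) - a * b⟩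

theorem parabolaChord_zero (a b : ℝ) : parabolaChord a b 0 = parabolaPoint a := by
  apply Complex.ext <;> simp [parabolaChord, parabolaPoint]; ring

theorem parabolaChord_one (a b : ℝ) : parabolaChord a b 1 = parabolaPoint b := by
  apply Complex.ext <;> simp [parabolaChord, parabolaPoint]; ring

theorem parabolaChord_continuous (a b : ℝ) : Continuous (parabolaChord a b) := by
  have : parabolaChord a b = fun t : unitInterval =>
      (((a + t * (b - a) : ℝ) : ℂ) + ((a + b) * (a + t * (b - a)) - a * b : ℝ) * Complex.I) := by
    funext t
    exact Complex.mk_eq_add_mul_I _ _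
  rw [this]
  fun_prop

theorem parabolaChord_injective {a b : ℝ} (h : a < b) : Function.Injective (parabolaChord a b) := by
  intro t t' htt'
  have := congrArg Complex.re htt'
  simp only [parabolaChord, add_right_inj, mul_eq_mul_right_iff, sub_eq_zero] at this
  exact Subtype.ext (this.resolve_right h.ne')

/-- The height of a point of a chord above the parabola. -/
theorem parabolaChord_im_sub (a b : ℝ) (t : unitInterval) :
    (parabolaChord a b t).im - (parabolaChord a b t).re ^ 2 = t * (1 - t) * (b - a) ^ 2 := by
  simp only [parabolaChord]; ring

theorem parabolaChord_re_sq_le (a b : ℝ) (t : unitInterval) :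
    (parabolaChord a b t).re ^ 2 ≤ (parabolaChord a b t).im := by
  have h₁ := parabolaChord_im_sub a b t
  have h₂ : 0 ≤ (t : ℝ) * (1 - t) * (b - a) ^ 2 :=
    mul_nonneg (mul_nonneg t.2.1 (sub_nonneg.mpr t.2.2)) (sq_nonneg _)
  linarith

theorem eq_zero_or_one_of_mem_parabola {a b : ℝ} (h : a < b) {t : unitInterval} {x : ℝ}
    (ht : parabolaChord a b t = parabolaPoint x) : t = 0 ∨ t = 1 := by
  have h₁ := parabolaChord_im_sub a b t
  rw [ht] at h₁
  have h₂ : (b - a) ^ 2 ≠ 0 := pow_ne_zero _ (sub_ne_zero.mpr h.ne')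
  rw [eq_comm, parabolaPoint, sub_self, mul_eq_zero, or_iff_left h₂, mul_eq_zero,
    sub_eq_zero] at h₁
  exact h₁.imp (fun h => Subtype.ext h) fun h => Subtype.ext h.symm

/-- Chords of the parabola that do not interleave meet at most in their endpoints. -/
theorem parabolaChord_disjoint {a b c d : ℝ} (hab : a < b) (hcd : c < d)
    (hne : ¬ (a = c ∧ b = d)) (h₁ : ¬ (a < c ∧ c < b ∧ b < d)) (h₂ : ¬ (c < a ∧ a < d ∧ d < b))
    {t t' : unitInterval} (h : parabolaChord a b t = parabolaChord c d t') :
    (t = 0 ∨ t = 1) ∧ (t' = 0 ∨ t' = 1) := by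
  set x := a + t * (b - a) with hx
  have hre : x = c + t' * (d - c) := congrArg Complex.re h
  have him : (a + b) * x - a * b = (c + d) * x - c * d := by
    have := congrArg Complex.im h
    simp only [parabolaChord] at this
    rw [← hx, ← hre] at this
    exact this
  have hax : a ≤ x := by nlinarith [t.2.1]
  have hxb : x ≤ b := by nlinarith [t.2.2]
  have hcx : c ≤ x := by nlinarith [t'.2.1]
  have hxd : x ≤ d := by nlinarith [t'.2.2]
  have hends : ((x = a ∨ x = b) ∧ (x = c ∨ x = d)) → (t = 0 ∨ t = 1) ∧ (t' = 0 ∨ t' = 1) := by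
    rintro ⟨hab', hcd'⟩
    constructor
    · refine eq_zero_or_one_of_mem_parabola hab (x := x) (Complex.ext rfl ?_)
      simp only [parabolaChord, parabolaPoint, ← hx]
      rcases hab' with h | h <;> rw [h] <;> ring
    · refine eq_zero_or_one_of_mem_parabola hcd (x := x) (Complex.ext hre.symm ?_)
      simp only [parabolaChord, parabolaPoint, ← hre]
      rcases hcd' with h | h <;> rw [h] <;> ring
  -- Both sides are the height of the common point above the parabola.
  have hprod : (x - a) * (b - x) = (x - c) * (d - x) := by linarith
  -- Over the open inner interval the chord of a strictly larger interval is strictly higher, so the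
  -- chords can meet only at height zero.
  have nested : ∀ {a b c d : ℝ}, a ≤ c → d ≤ b → ¬ (a = c ∧ b = d) → c ≤ x → x ≤ d →
      (x - a) * (b - x) = (x - c) * (d - x) → (x = a ∨ x = b) ∧ (x = c ∨ x = d) := by
    intro a b c d hac hdb hne hcx hxd hprod
    have hzero : (x - c) * (d - x) = 0 := by
      by_contra hpos
      have hpos := lt_of_le_of_ne
        (mul_nonneg (sub_nonneg.mpr hcx) (sub_nonneg.mpr hxd)) (Ne.symm hpos)
      have h₁ : 0 < x - c := lt_of_le_of_ne (sub_nonneg.mpr hcx) fun h => by simp [← h] at hpos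
      have h₂ : 0 < d - x := lt_of_le_of_ne (sub_nonneg.mpr hxd) fun h => by simp [← h] at hpos
      refine hne ⟨?_, ?_⟩ <;> nlinarith
    rw [hzero] at hprod
    simp only [mul_eq_zero, sub_eq_zero] at hprod hzero
    exact ⟨hprod.imp id Eq.symm, hzero.imp id Eq.symm⟩
  rcases le_or_gt b c with hbc | hbc
  · exact hends ⟨Or.inr (by linarith), Or.inl (by linarith)⟩
  rcases le_or_gt d a with hda | hda
  · exact hends ⟨Or.inl (by linarith), Or.inr (by linarith)⟩
  rcases le_total a c with hac | hac
  · rcases le_or_gt d b with hdb | hdb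
    · exact hends (nested hac hdb hne hcx hxd hprod)
    · rcases hac.lt_or_eq with hac' | rfl
      · exact absurd ⟨hac', hbc, hdb⟩ h₁
      · exact hends (nested le_rfl hdb.le (fun h => hne ⟨h.1.symm, h.2.symm⟩) hax hxb
          hprod.symm).symm
  · rcases le_or_gt b d with hbd | hbd
    · exact hends (nested hac hbd (fun h => hne ⟨h.1.symm, h.2.symm⟩) hax hxb hprod.symm).symm
    · rcases hac.lt_or_eq with hac' | rfl
      · exact absurd ⟨hac', hda, hbd⟩ h₂
      · exact hends (nested le_rfl hbd.le hne hcx hxd hprod)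

/-- A graph whose vertices can be ordered on a line such that no two edges interleave is
outerplanar. -/
theorem isOuterplanar_of_noncrossing {V : Type*} {G : SimpleGraph V} (pos : V → ℕ)
    (hpos : Function.Injective pos)
    (hcross : ∀ u v u' v', G.Adj u v → G.Adj u' v' →
      ¬ (pos u < pos u' ∧ pos u' < pos v ∧ pos v < pos v')) : IsOuterplanar G := by
  have hinf : ∀ e : G.edgeSet, ∃ uv : V × V, (e : Sym2 V) = s(uv.1, uv.2) ∧ G.Adj uv.1 uv.2 ∧
      pos uv.1 < pos uv.2 := by
    rintro ⟨e, he⟩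
    induction e with
    | _ u v =>
      rw [SimpleGraph.mem_edgeSet] at he
      rcases lt_or_gt_of_ne (hpos.ne he.ne) with h | h
      · exact ⟨(u, v), rfl, he, h⟩
      · exact ⟨(v, u), Sym2.eq_swap, he.symm, h⟩
  choose ends hends hadj hlt using hinf
  have hlt' : ∀ e, (pos (ends e).1 : ℝ) < pos (ends e).2 := fun e => Nat.cast_lt.mpr (hlt e)
  let D : PlaneDrawing G :=
    { point := fun v => parabolaPoint (pos v)
      point_injective := fun u v h => hpos (by simpa [parabolaPoint] using congrArg Complex.re h)
      arc := fun e => parabolaChord (pos (ends e).1) (pos (ends e).2)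
      arc_continuous := fun e => parabolaChord_continuous _ _
      arc_injective := fun e => parabolaChord_injective (hlt' e)
      arc_ends := fun e => by
        rw [hends e, parabolaChord_zero, parabolaChord_one, Sym2.map_mk]
      arc_avoids := fun e t v h => eq_zero_or_one_of_mem_parabola (hlt' e) h
      arc_disjoint := fun e e' hne t t' h => by
        refine parabolaChord_disjoint (hlt' e) (hlt' e') ?_ ?_ ?_ h
        · rintro ⟨h₁, h₂⟩
          refine hne (Subtype.ext ?_)
          rw [hends e, hends e', hpos (Nat.cast_injective h₁), hpos (Nat.cast_injective h₂)]
        · exact_mod_cast hcross _ _ _ _ (hadj e) (hadj e')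
        · exact_mod_cast hcross _ _ _ _ (hadj e') (hadj e) }
  have hsupport : ∀ z ∈ D.support, z.re ^ 2 ≤ z.im := by
    rintro z (⟨v, rfl⟩ | hz)
    · exact le_rfl
    · obtain ⟨e, t, rfl⟩ := Set.mem_iUnion.mp hz
      exact parabolaChord_re_sq_le _ _ _
  refine ⟨D, fun v => ?_⟩
  set x : ℝ := (pos v : ℝ) with hx
  -- The drawing lies on or above the parabola, so the open vertical ray below a vertex misses it.
  -- The ray is connected and unbounded, hence in the outer face, and it ends at the vertex.
  let ray : ℝ → ℂ := fun s => ⟨x, x ^ 2 - s⟩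
  have hray : Continuous ray := by
    have : ray = fun s => ((x : ℂ) + ((x ^ 2 - s : ℝ) : ℂ) * Complex.I) := by
      funext s
      exact Complex.mk_eq_add_mul_I _ _
    rw [this]
    fun_prop
  have hsub : ray '' Set.Ioi 0 ⊆ D.supportᶜ := by
    rintro _ ⟨s, hs, rfl⟩ hmem
    have h₁ : x ^ 2 ≤ x ^ 2 - s := hsupport _ hmem
    have h₂ : 0 < s := hs
    linarith
  have hmem : ∀ s > 0, ray s ∈ D.outerFace := by
    refine fun s hs => ⟨hsub ⟨s, hs, rfl⟩, fun hbdd => ?_⟩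
    have hcomp : ray '' Set.Ioi 0 ⊆ connectedComponentIn D.supportᶜ (ray s) :=
      (isPreconnected_Ioi.image _ hray.continuousOn).subset_connectedComponentIn ⟨s, hs, rfl⟩ hsub
    obtain ⟨C, hC⟩ := (hbdd.subset hcomp).exists_norm_le
    -- At this parameter the imaginary part is `-(|C| + 1)`, beyond the supposed bound.
    have hs' : (0 : ℝ) < x ^ 2 + |C| + 1 := by positivity
    have h₁ := hC _ ⟨_, hs', rfl⟩
    have h₂ := Complex.abs_im_le_norm (ray (x ^ 2 + |C| + 1))
    have h₃ : (ray (x ^ 2 + |C| + 1)).im = -(|C| + 1) := by simp only [ray]; ring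
    rw [h₃, abs_neg, abs_of_pos (by positivity)] at h₂
    linarith [le_abs_self C]
  have hpoint : D.point v = ray 0 := by simp [D, ray, parabolaPoint, hx]
  refine ⟨?_, fun hint => (interior_subset hint).1 (Or.inl ⟨v, rfl⟩)⟩
  rw [hpoint]
  refine mem_closure_of_tendsto (f := ray) (b := nhdsWithin 0 (Set.Ioi 0))
    (hray.continuousAt.tendsto.mono_left nhdsWithin_le_nhds) ?_
  filter_upwards [self_mem_nhdsWithin] with s hs using hmem s hs

/-! ### The outer cycle of the graph -/

namespace fanGraph

/-- The position of a vertex on the outer cycle `r, w₀, v₁, w₁, …, v₄₈, w₄₈`. -/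
def cyclePos : FanVertex → ℕ
  | .r => 0
  | .w i => 2 * i + 1
  | .v j => 2 * j + 2

theorem cyclePos_injective : Function.Injective cyclePos := by
  intro u v h
  cases u <;> cases v <;> simp only [cyclePos, w.injEq, v.injEq, reduceCtorEq, Fin.ext_iff] at h ⊢
    <;> omega

theorem cyclePos_of_adj {u v : FanVertex} (h : fanGraph.Adj u v) (hlt : cyclePos u < cyclePos v) :
    cyclePos u = 0 ∧ cyclePos v % 2 = 1 ∨ cyclePos v = cyclePos u + 1 ∨
      cyclePos u % 2 = 1 ∧ cyclePos v = cyclePos u + 2 := by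
  cases u <;> cases v <;>
    simp only [fanGraph, SimpleGraph.fromRel_adj, FanEdge, Fin.ext_iff, Fin.val_castSucc,
      Fin.val_succ, or_false, false_or, and_false, true_and, cyclePos] at h hlt ⊢ <;> omega

theorem isOuterplanar : IsOuterplanar fanGraph := by
  refine isOuterplanar_of_noncrossing cyclePos cyclePos_injective ?_
  rintro u v u' v' h h' ⟨h₁, h₂, h₃⟩
  -- Interleaving makes `cyclePos u'` positive, so the second edge spans at most two positions and
  -- has `cyclePos v` strictly inside. Thus it joins two odd positions around the even position of
  -- `v`, and the first edge cannot end there from the left of `u'`.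
  have := cyclePos_of_adj h (by omega)
  have := cyclePos_of_adj h' (by omega)
  omega

end fanGraph

theorem theorem4 :
    Nat.card FanVertex = 98 ∧ IsOuterplanar fanGraph ∧ IsKTree fanGraph 2 ∧
      connectedGameChromaticNumber fanGraph = 5 ∧ connectedGameColoringNumber fanGraph = 5 :=
  ⟨FanVertex.card_eq, fanGraph.isOuterplanar, fanGraph.isKTree,
    fanGraph.connectedGameChromaticNumber_eq, fanGraph.connectedGameColoringNumber_eq⟩
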